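/- Let $\Omega^+\subset\mathbb{C}=\mathbb{R}^2$ be a polygonal billiard table: the compact region bounded by a simple closed polygon $B^+$. Let $A^+\subseteq B^+$ be a nondegenerate vertical segment containing no corner of $B^+$, let $\rho$ be the reflection in a vertical line that does not meet the interior of $\Omega^+$, and put $\Omega^-=\rho(\Omega^+)$, $B^-=\rho(B^+)$, $A^-=\rho(A^+)$. The phase space of the polygonal Andreev billiard is $((\Omega^+\sqcup\Omega^-)\times S^1)/\sim_\pm$, where $\sim_\pm$ is the equivalence relation given, besides equality, by - $(x,\theta)\sim_\pm(x,r(\theta))$ for $x$ a point of $B^+$ (or of $B^-$) that is neither a corner nor in $A^+$ (resp. $A^-$), where $r$ is the reflection of directions through the tangent line at $x$; - $(x,\theta)\sim_\pm(\rho(x),r(\theta)+\pi)$ for $x$ in $A^+$ (or in $A^-$), $\rho(x)$ being taken in the other copy and $r$ being the reflection through the vertical. The Andreev flow $\Phi_\pm^t$ moves a point in the interior of either table at unit speed along its direction; when it arrives at a boundary point that is not a corner, it continues along the inward-pointing representative of its $\sim_\pm$-class. An orbit is defined for all times $t\in\mathbb{R}$ only if it never meets a corner. For a direction $\theta$, let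 $M^\pm_\theta$ be the set of classes of all $(x,\theta')$ with $x\in\Omega^+\sqcup\Omega^-$ and $\theta'$ obtained from $\theta$ by finitely many reflections in the sides of the two tables and changes of direction $\theta\mapsto r(\theta)+\pi$ at the Andreev segments; this set is invariant under the flow. Suppose that the polygon is rational, i.e. every interior angle of $B^+$ is a rational multiple of $\pi$. Then for Lebesgue-almost every direction $\theta$ the flow restricted to $M^\pm_\theta$ is closed: for every orbit $t\mapsto\Phi_\pm^t(p)$, $p\in M^\pm_\theta$, that is defined for all $t\in\mathbb{R}$, there is $T>0$ such that $\Phi_\pm^{t+T}(p)=\Phi_\pm^{t}(p)$ for all $t\in\mathbb{R}$. -/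

import Mathlib

open Set MeasureTheory

noncomputable section

/-- A polygonal billiard table in the plane `ℂ`: a compact region whose boundary is the simple
closed polygon with cyclically indexed vertices `vertex i`. -/
structure PolygonalBilliard where
  n : ℕ
  three_le : 3 ≤ n
  vertex : ZMod n → ℂ
  vertex_injective : Function.Injective vertex
  /-- consecutive sides meet only in their common vertex -/
  side_inter_next : ∀ i, segment ℝ (vertex i) (vertex (i + 1)) ∩
    segment ℝ (vertex (i + 1)) (vertex (i + 1 + 1)) = {vertex (i + 1)}
  /-- sides that are not consecutive are disjoint -/
  side_disjoint : ∀ i j, j ≠ i → j ≠ i + 1 → i ≠ j + 1 →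
    Disjoint (segment ℝ (vertex i) (vertex (i + 1))) (segment ℝ (vertex j) (vertex (j + 1)))
  /-- the closed region bounded by the polygon -/
  table : Set ℂ
  isCompact_table : IsCompact table
  closure_interior_table : closure (interior table) = table
  isConnected_interior_table : IsConnected (interior table)
  frontier_table : frontier table = ⋃ i, segment ℝ (vertex i) (vertex (i + 1))

namespace PolygonalBilliard

variable (P : PolygonalBilliard)

/-- The side from `vertex i` to `vertex (i + 1)` without its end points. -/
def openSide (i : ZMod P.n) : Set ℂ := openSegment ℝ (P.vertex i) (P.vertex (i + 1))

/-- The sum of the two unit vectors that point from `vertex i` along the sides that meet there. -/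
def bisector (i : ZMod P.n) : ℂ :=
  (‖P.vertex (i + 1) - P.vertex i‖⁻¹ : ℝ) • (P.vertex (i + 1) - P.vertex i) +
    (‖P.vertex (i - 1) - P.vertex i‖⁻¹ : ℝ) • (P.vertex (i - 1) - P.vertex i)

open Classical in
/-- The interior angle at `vertex i`, in `(0, 2π)`: the angle between the two sides if the table
lies locally between them (the bisector points into the table), and `2π` minus it otherwise. -/
def interiorAngle (i : ZMod P.n) : ℝ :=
  if ∃ ε > 0, ∀ t ∈ Ioo (0 : ℝ) ε, P.vertex i + t • P.bisector i ∈ interior P.table then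
    EuclideanGeometry.angle (P.vertex (i - 1)) (P.vertex i) (P.vertex (i + 1))
  else
    2 * Real.pi - EuclideanGeometry.angle (P.vertex (i - 1)) (P.vertex i) (P.vertex (i + 1))

/-- A rational polygon: every interior angle is a rational multiple of `π`. -/
def IsRational : Prop := ∀ i, ∃ q : ℚ, P.interiorAngle i = q * Real.pi

theorem vertex_ne_succ (i : ZMod P.n) : P.vertex i ≠ P.vertex (i + 1) := by
  intro h
  have h1 := P.vertex_injective h
  have : Fact (1 < P.n) := ⟨by have := P.three_le; omega⟩
  exact one_ne_zero (α := ZMod P.n) (by simpa using h1.symm)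

theorem openSide_inter_next (i : ZMod P.n) {z : ℂ} (h : z ∈ P.openSide i)
    (h' : z ∈ P.openSide (i + 1)) : False := by
  have hz : z ∈ ({P.vertex (i + 1)} : Set ℂ) := by
    rw [← P.side_inter_next i]
    exact ⟨openSegment_subset_segment ℝ _ _ h, openSegment_subset_segment ℝ _ _ h'⟩
  rw [mem_singleton_iff] at hz
  subst hz
  exact P.vertex_ne_succ i (right_mem_openSegment_iff.mp h)

/-- A boundary point that is not a corner lies on one side only. -/
theorem openSide_unique {i j : ZMod P.n} {z : ℂ} (hi : z ∈ P.openSide i)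
    (hj : z ∈ P.openSide j) : i = j := by
  by_contra hij
  by_cases h1 : j = i + 1
  · subst h1
    exact P.openSide_inter_next i hi hj
  by_cases h2 : i = j + 1
  · subst h2
    exact P.openSide_inter_next j hj hi
  exact Set.disjoint_left.mp (P.side_disjoint i j (Ne.symm hij) h1 h2)
    (openSegment_subset_segment ℝ _ _ hi) (openSegment_subset_segment ℝ _ _ hj)

end PolygonalBilliard

/-- The two copies of the table, labelled by the parity of the point mass. -/
inductive Parity where
  | plus
  | minus

/-- The other parity. -/
def Parity.flip : Parity → Parity
  | .plus => .minus
  | .minus => .plus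

/-- Reflection of the direction `θ` through a line that makes the angle `α` with the horizontal. -/
def reflectDir (α θ : Real.Angle) : Real.Angle := (2 : ℕ) • α - θ

/-- The change of direction at the Andreev subset: reflection through the vertical tangent line
followed by a half turn, `θ ↦ r(θ) + π`. -/
def andreevDir (θ : Real.Angle) : Real.Angle :=
  reflectDir ((Real.pi / 2 : ℝ) : Real.Angle) θ + ((Real.pi : ℝ) : Real.Angle)

theorem reflectDir_reflectDir (α θ : Real.Angle) : reflectDir α (reflectDir α θ) = θ := by
  simp [reflectDir]

theorem andreevDir_eq_neg (θ : Real.Angle) : andreevDir θ = -θ := by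
  have h : (2 : ℕ) • ((Real.pi / 2 : ℝ) : Real.Angle) = ((Real.pi : ℝ) : Real.Angle) := by
    rw [← Real.Angle.coe_nsmul]
    congr 1
    simp
    ring
  have h2 := Real.Angle.coe_pi_add_coe_pi
  unfold andreevDir reflectDir
  rw [h, sub_add_eq_add_sub, h2, zero_sub]

/-- A polygonal Andreev billiard: a polygonal billiard `Ω⁺` together with a nondegenerate vertical
segment `A⁺` of its boundary that contains no corner, and a vertical line `Re z = axis` that does
not meet the interior of `Ω⁺`. The second table `Ω⁻` is the mirror image of `Ω⁺` in that line. -/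
structure PolygonalAndreevBilliard extends PolygonalBilliard where
  andreevSegment : Set ℂ
  andreevSegment_nontrivial : andreevSegment.Nontrivial
  andreevSegment_connected : IsConnected andreevSegment
  andreevSegment_subset : andreevSegment ⊆ frontier table \ range vertex
  andreevSegment_vertical : ∀ z ∈ andreevSegment, ∀ w ∈ andreevSegment, z.re = w.re
  axis : ℝ
  axis_disjoint : ∀ z ∈ interior table, z.re ≠ axis

namespace PolygonalAndreevBilliard

variable (P : PolygonalAndreevBilliard)

/-- The reflection `ρ` through the line `Re z = axis`. -/
def rho (z : ℂ) : ℂ := ⟨2 * P.axis - z.re, z.im⟩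

/-- The map that carries `Ω⁺` to the table of the given parity: the identity or `ρ`. -/
def place : Parity → ℂ → ℂ
  | .plus, z => z
  | .minus, z => P.rho z

/-- The tables `Ω⁺` and `Ω⁻ = ρ(Ω⁺)`. -/
def tableOf (ε : Parity) : Set ℂ := P.place ε '' P.table

/-- The interiors of `Ω⁺` and `Ω⁻`. -/
def insideOf (ε : Parity) : Set ℂ := interior (P.tableOf ε)

/-- The corners of `Ω⁺` and `Ω⁻`. -/
def vertexOf (ε : Parity) (i : ZMod P.n) : ℂ := P.place ε (P.vertex i)

/-- The open sides of `Ω⁺` and `Ω⁻`. -/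
def openSideOf (ε : Parity) (i : ZMod P.n) : Set ℂ := P.place ε '' P.openSide i

/-- The two parts `A⁺` and `A⁻ = ρ(A⁺)` of the Andreev subset. -/
def andreevOf (ε : Parity) : Set ℂ := P.place ε '' P.andreevSegment

/-- The angle between the `i`-th side of the table of parity `ε` and the horizontal. -/
def sideAngle (ε : Parity) (i : ZMod P.n) : Real.Angle :=
  ((Complex.arg (P.vertexOf ε (i + 1) - P.vertexOf ε i) : ℝ) : Real.Angle)

/-- A point of `(Ω⁺ ⊔ Ω⁻) × S¹`. -/
@[ext]
structure State where
  parity : Parity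
  pos : ℂ
  dir : Real.Angle
  pos_mem : pos ∈ P.tableOf parity

variable {P}

/-- The relation `∼±` on `(Ω⁺ ⊔ Ω⁻) × S¹`. Besides equality, it identifies a direction at a
boundary point off the Andreev subset and off the corners with its mirror image in the tangent
line, and `(x, θ)` with `(ρ(x), r(θ) + π)` for `x` in the Andreev subset. -/
inductive Rel : P.State → P.State → Prop
  | refl (p : P.State) : Rel p p
  | side (p q : P.State) (i : ZMod P.n) (hparity : q.parity = p.parity) (hpos : q.pos = p.pos)
      (hside : p.pos ∈ P.openSideOf p.parity i) (hA : p.pos ∉ P.andreevOf p.parity)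
      (hdir : q.dir = reflectDir (P.sideAngle p.parity i) p.dir) : Rel p q
  | andreev (p q : P.State) (hparity : q.parity = p.parity.flip) (hpos : q.pos = P.rho p.pos)
      (hA : p.pos ∈ P.andreevOf p.parity) (hdir : q.dir = andreevDir p.dir) : Rel p q

theorem rho_rho (z : ℂ) : P.rho (P.rho z) = z := by
  apply Complex.ext <;> simp [rho]

theorem place_injective (ε : Parity) : Function.Injective (P.place ε) := by
  intro z w h
  cases ε
  · exact h
  · have h' : P.rho z = P.rho w := h
    rw [← rho_rho (P := P) z, h', rho_rho]

theorem rho_mem_andreevOf {ε : Parity} {z : ℂ} (h : z ∈ P.andreevOf ε) :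
    P.rho z ∈ P.andreevOf ε.flip := by
  obtain ⟨w, hw, rfl⟩ := h
  cases ε
  · exact ⟨w, hw, rfl⟩
  · exact ⟨w, hw, (rho_rho w).symm⟩

theorem openSideOf_unique {ε : Parity} {i j : ZMod P.n} {z : ℂ} (hi : z ∈ P.openSideOf ε i)
    (hj : z ∈ P.openSideOf ε j) : i = j := by
  obtain ⟨a, ha, rfl⟩ := hi
  obtain ⟨b, hb, hab⟩ := hj
  rw [place_injective ε hab] at hb
  exact P.toPolygonalBilliard.openSide_unique ha hb

theorem Rel.symm {p q : P.State} (h : Rel p q) : Rel q p := by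
  cases h with
  | refl => exact Rel.refl _
  | side _ i hparity hpos hside hA hdir =>
    refine Rel.side _ _ i hparity.symm hpos.symm ?_ ?_ ?_
    · rw [hpos, hparity]; exact hside
    · rw [hpos, hparity]; exact hA
    · rw [hparity, hdir, reflectDir_reflectDir]
  | andreev _ hparity hpos hA hdir =>
    refine Rel.andreev _ _ ?_ ?_ ?_ ?_
    · rw [hparity]; cases p.parity <;> rfl
    · rw [hpos, rho_rho]
    · rw [hpos, hparity]; exact rho_mem_andreevOf hA
    · rw [hdir, andreevDir_eq_neg, andreevDir_eq_neg, neg_neg]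

theorem Rel.trans {p q s : P.State} (h : Rel p q) (h' : Rel q s) : Rel p s := by
  cases h with
  | refl => exact h'
  | side _ i hparity hpos hside hA hdir =>
    cases h' with
    | refl => exact Rel.side _ _ i hparity hpos hside hA hdir
    | side _ j hparity' hpos' hside' hA' hdir' =>
      rw [hpos, hparity] at hside'
      have hij := openSideOf_unique hside hside'
      subst hij
      have : p = s := by
        apply State.ext
        · rw [hparity', hparity]
        · rw [hpos', hpos]
        · rw [hdir', hparity, hdir, reflectDir_reflectDir]
      subst this
      exact Rel.refl _
    | andreev _ hparity' hpos' hA' hdir' =>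
      rw [hpos, hparity] at hA'
      exact absurd hA' hA
  | andreev _ hparity hpos hA hdir =>
    cases h' with
    | refl => exact Rel.andreev _ _ hparity hpos hA hdir
    | side _ j hparity' hpos' hside' hA' hdir' =>
      rw [hpos, hparity] at hA'
      exact absurd (rho_mem_andreevOf hA) hA'
    | andreev _ hparity' hpos' hA' hdir' =>
      have : p = s := by
        apply State.ext
        · rw [hparity', hparity]; cases p.parity <;> rfl
        · rw [hpos', hpos, rho_rho]
        · rw [hdir', hdir, andreevDir_eq_neg, andreevDir_eq_neg, neg_neg]
      subst this
      exact Rel.refl _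

variable (P)

/-- `∼±` as an equivalence relation. -/
def stateSetoid : Setoid P.State where
  r := Rel
  iseqv := ⟨Rel.refl, Rel.symm, Rel.trans⟩

/-- The phase space `((Ω⁺ ⊔ Ω⁻) × S¹) / ∼±`. -/
def PhaseSpace : Type := Quotient P.stateSetoid

variable {P}

/-- The class of a state in the phase space. -/
def toPhase (p : P.State) : P.PhaseSpace := Quotient.mk P.stateSetoid p

/-- The base point of the class `x` is a corner. -/
def AtCorner (x : P.PhaseSpace) : Prop :=
  ∃ p : P.State, toPhase p = x ∧ p.pos ∈ range (P.vertexOf p.parity)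

/-- `w` is reached from `p` by unit speed motion along a straight line for the (positive or
negative) time `s`, and `w` lies in the interior of the table. -/
def FreeMotion (p : P.State) (s : ℝ) (w : P.State) : Prop :=
  w.parity = p.parity ∧ w.dir = p.dir ∧ w.pos = p.pos + s * (p.dir.toCircle : ℂ) ∧
    w.pos ∈ P.insideOf w.parity

/-- `c` is an orbit `t ↦ Φ^t(c 0)` of the Andreev flow, defined for all times: it never meets a
corner, and around each time `t` it moves freely, arriving along the direction of one
representative `q` of `c t` and departing along the direction of one representative `p` of `c t`.
(In the interior `p = q`; at the boundary `q` points outward and `p` inward.) -/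
def IsFlowLine (c : ℝ → P.PhaseSpace) : Prop :=
  ∀ t : ℝ, ¬ AtCorner (c t) ∧ ∃ p q : P.State, toPhase p = c t ∧ toPhase q = c t ∧
    ∃ δ > 0, (∀ s ∈ Ioo (0 : ℝ) δ, ∃ w, toPhase w = c (t + s) ∧ FreeMotion p s w) ∧
      (∀ s ∈ Ioo (-δ) (0 : ℝ), ∃ w, toPhase w = c (t + s) ∧ FreeMotion q s w)

variable (P)

/-- The directions `θ, θ₁, θ₂, …` that arise from `θ` through reflections in the sides of the two
tables and through the change of direction at the Andreev subset. -/
inductive IsDirectionFrom (θ : Real.Angle) : Real.Angle → Prop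
  | base : IsDirectionFrom θ θ
  | side (ε : Parity) (i : ZMod P.n) (u : Real.Angle) (hu : IsDirectionFrom θ u) :
      IsDirectionFrom θ (reflectDir (P.sideAngle ε i) u)
  | andreev (u : Real.Angle) (hu : IsDirectionFrom θ u) : IsDirectionFrom θ (andreevDir u)

/-- The invariant surface `M±_θ` in the phase space. -/
def invariantSurface (θ : Real.Angle) : Set P.PhaseSpace :=
  toPhase '' {p : P.State | P.IsDirectionFrom θ p.dir}

variable {P}

/-- The flow restricted to `M` is closed: all its orbits in `M` are periodic. -/
def FlowIsClosedOn (M : Set P.PhaseSpace) : Prop :=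
  ∀ c : ℝ → P.PhaseSpace, IsFlowLine c → c 0 ∈ M → ∃ T > 0, Function.Periodic c T

end PolygonalAndreevBilliard

end

/-! Carry both tables to `Ω⁺` by `ρ`. A flow line then becomes an ordinary billiard path in `Ω⁺`,
except that the ball turns back, `v ↦ -v`, where it hits the Andreev segment. The retroreflection
`(x, θ) ↦ (ρ(x), r(θ) + π)` reverses time and fixes the classes over the Andreev segment, so a flow
line `c` that hits the segment at the time `a` satisfies `c (2a - t) = R (c t)`. If it hits the
segment at two times `a < b`, the product of the two symmetries shows that `2(b - a)` is a period.

It remains to see that almost every orbit hits the segment in the future; time reversal then gives a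
hit in the past. In a rational polygon a direction `θ` generates only finitely many directions, and
for all but countably many `θ` no line in any of these directions joins two corners of unfolded
copies of the table. For such `θ`, the first return to the boundary is an exchange of finitely many
intervals, whose transverse coordinate reverses at each reflection, and this exchange has no
connections between its singular points. As in Keane's theorem, it is minimal: every infinite
forward orbit of the billiard is dense in the boundary, hence visits the interior of the Andreev
segment. -/

open Filter Topology

/-! ### Interval exchanges with flips -/

/-- An interval exchange with flips in which every branch reverses the orientation. The points are
pairs `(a, s)` with `s` in the bounded interval `dom a`, and `Step x y` says that the exchange is
defined at `x` and sends it to `y`. Only finitely many points have no image or no preimage; the last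
two fields exclude saddle connections and periodic points. -/
structure FlippedIntervalExchange (α : Type*) where
  dom : α → Set ℝ
  Step : α × ℝ → α × ℝ → Prop
  convex_dom : ∀ a, Convex ℝ (dom a)
  isOpen_dom : ∀ a, IsOpen (dom a)
  isBounded_dom : ∀ a, Bornology.IsBounded (dom a)
  mem_left : ∀ {x y}, Step x y → x.2 ∈ dom x.1
  mem_right : ∀ {x y}, Step x y → y.2 ∈ dom y.1
  right_unique : ∀ {x y z}, Step x y → Step x z → y = z
  left_unique : ∀ {x y z}, Step x z → Step y z → x = y
  isometry : ∀ {x y}, Step x y → ∀ᶠ h in 𝓝 (0 : ℝ), Step (x.1, x.2 + h) (y.1, y.2 - h)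
  finite_no_image : {x : α × ℝ | x.2 ∈ dom x.1 ∧ ∀ y, ¬ Step x y}.Finite
  finite_no_preimage : {x : α × ℝ | x.2 ∈ dom x.1 ∧ ∀ y, ¬ Step y x}.Finite
  no_connection : ∀ {x y}, x.2 ∈ dom x.1 → (∀ w, ¬ Step w x) →
    Relation.ReflTransGen Step x y → ∃ z, Step y z
  no_periodic : ∀ x, ¬ Relation.TransGen Step x x

namespace FlippedIntervalExchange

variable {α : Type*} (S : FlippedIntervalExchange α)

/-- The inverse exchange. -/
def inverse : FlippedIntervalExchange α where
  dom := S.dom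
  Step x y := S.Step y x
  convex_dom := S.convex_dom
  isOpen_dom := S.isOpen_dom
  isBounded_dom := S.isBounded_dom
  mem_left := S.mem_right
  mem_right := S.mem_left
  right_unique := S.left_unique
  left_unique := S.right_unique
  isometry {x y} hyx := by
    have hneg : Tendsto (fun h : ℝ => -h) (𝓝 0) (𝓝 0) := by simpa using tendsto_neg (0 : ℝ)
    filter_upwards [hneg.eventually (S.isometry hyx)] with h hh
    simpa only [sub_neg_eq_add, ← sub_eq_add_neg] using hh
  finite_no_image := S.finite_no_preimage
  finite_no_preimage := S.finite_no_image
  no_connection {x y} hx hx' hxy := by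
    by_contra! hy
    have hyx : Relation.ReflTransGen S.Step y x := Relation.reflTransGen_swap.mp hxy
    have hydom : y.2 ∈ S.dom y.1 := by
      rcases hyx.cases_head with rfl | ⟨z, hyz, -⟩
      exacts [hx, S.mem_left hyz]
    exact (S.no_connection hydom hy hyx).elim hx'
  no_periodic x h := S.no_periodic x (Relation.transGen_swap.mp h)

theorem eventually_step {x y : α × ℝ} {v r₀ : ℝ}
    (h : S.Step (x.1, x.2 + r₀ * v) (y.1, y.2 - r₀ * v)) :
    ∀ᶠ r in 𝓝 r₀, S.Step (x.1, x.2 + r * v) (y.1, y.2 - r * v) := by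
  have htendsto : Tendsto (fun r => (r - r₀) * v) (𝓝 r₀) (𝓝 0) := by
    have : Continuous fun r => (r - r₀) * v := by fun_prop
    simpa using this.tendsto r₀
  filter_upwards [htendsto.eventually (S.isometry h)] with r hr
  convert hr using 2 <;> ring

theorem step_along {x y : α × ℝ} (hxy : S.Step x y) {v s : ℝ} (hs : 0 < s)
    (himage : ∀ r ∈ Ioo 0 s, ∃ z, S.Step (x.1, x.2 + r * v) z) :
    ∀ r ∈ Ico 0 s, S.Step (x.1, x.2 + r * v) (y.1, y.2 - r * v) := by
  let shifted (z : α × ℝ) : Set ℝ := {r | S.Step (x.1, x.2 + r * v) (z.1, z.2 - r * v)}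
  have hopen (z) : IsOpen (shifted z) := isOpen_iff_mem_nhds.2 fun _ hr => S.eventually_step hr
  have hmem : 0 ∈ shifted y := by simpa [shifted] using hxy
  have hdisjoint : Disjoint (shifted y) (⋃ z ≠ y, shifted z) := by
    simp only [disjoint_iUnion_right]
    refine fun z hzy => disjoint_left.2 fun r hry hrz => hzy ?_
    simpa [Prod.ext_iff, eq_comm] using S.right_unique hry hrz
  have hcover : Ico 0 s ⊆ shifted y ∪ ⋃ z ≠ y, shifted z := by
    intro r hr
    rcases hr.1.eq_or_lt with rfl | hr0
    · exact .inl hmem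
    obtain ⟨z, hz⟩ := himage r ⟨hr0, hr.2⟩
    have hz' : r ∈ shifted (z.1, z.2 + r * v) := by simpa [shifted] using hz
    by_cases hzy : (z.1, z.2 + r * v) = y
    · exact .inl (hzy ▸ hz')
    · exact .inr (mem_biUnion hzy hz')
  exact isPreconnected_Ico.subset_left_of_subset_union (hopen y)
    (isOpen_biUnion fun z _ => hopen z) hdisjoint hcover ⟨0, left_mem_Ico.2 hs, hmem⟩

/-- The points `x + r v` with `0 < r < s` form a gap of `K` next to `x`: they belong to the domain
of the exchange and avoid `K`. -/
def IsGap (K : Set (α × ℝ)) (x : α × ℝ) (v s : ℝ) : Prop :=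
  ∀ r ∈ Ioo 0 s, x.2 + r * v ∈ S.dom x.1 ∧ (x.1, x.2 + r * v) ∉ K

variable {S} {K : Set (α × ℝ)} {x y : α × ℝ} {v s : ℝ}

theorem IsGap.mono (hgap : S.IsGap K x v s) {t : ℝ} (hts : t ≤ s) : S.IsGap K x v t :=
  fun r hr => hgap r ⟨hr.1, hr.2.trans_le hts⟩

theorem IsGap.ne (hgap : S.IsGap K y v s) (hx : x ∈ K) (hxy : x.1 = y.1) {r : ℝ}
    (hr : r ∈ Ioo 0 s) : x.2 ≠ y.2 + r * v := by
  intro h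
  exact (hgap r hr).2 (by rwa [← hxy, ← h])

theorem IsGap.map (hinv : ∀ x y, S.Step x y → (x ∈ K ↔ y ∈ K)) (hgap : S.IsGap K x v s)
    (hxy : S.Step x y) (himage : ∀ r ∈ Ioo 0 s, ∃ z, S.Step (x.1, x.2 + r * v) z) :
    S.IsGap K y (-v) s := by
  intro r hr
  have hstep := S.step_along hxy (hr.1.trans hr.2) himage r ⟨hr.1.le, hr.2⟩
  rw [mul_neg, ← sub_eq_add_neg]
  exact ⟨S.mem_right hstep, fun h => (hgap r hr).2 ((hinv _ _ hstep).2 h)⟩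

theorem IsGap.exists_map (hinv : ∀ x y, S.Step x y → (x ∈ K ↔ y ∈ K)) (hgap : S.IsGap K x v s)
    (hs : 0 < s) (hxy : S.Step x y) : ∃ t > 0, S.IsGap K y (-v) t := by
  obtain ⟨δ, hδ, hstep⟩ := Metric.eventually_nhds_iff.1
    (S.eventually_step (v := v) (r₀ := 0) (by simpa using hxy))
  refine ⟨min s δ, lt_min hs hδ, (hgap.mono (min_le_left _ _)).map hinv hxy fun r hr => ?_⟩
  refine ⟨_, hstep (y := r) ?_⟩
  rw [Real.dist_eq, sub_zero, abs_of_pos hr.1]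
  exact hr.2.trans_le (min_le_right _ _)

section Orbit

variable {b : ℕ → α × ℝ}

theorem exists_orbit (h : ∀ y, Relation.ReflTransGen S.Step x y → ∃ z, S.Step y z) :
    ∃ b : ℕ → α × ℝ, b 0 = x ∧ ∀ k, S.Step (b k) (b (k + 1)) := by
  choose! f hf using h
  have hreach (k : ℕ) : Relation.ReflTransGen S.Step x (f^[k] x) := by
    induction k with
    | zero => exact .refl
    | succ k ih =>
      rw [Function.iterate_succ_apply']
      exact .tail ih (hf _ ih)
  refine ⟨fun k => f^[k] x, rfl, fun k => ?_⟩
  simpa only [Function.iterate_succ_apply'] using hf _ (hreach k)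

theorem orbit_injective (hb : ∀ k, S.Step (b k) (b (k + 1))) : Function.Injective b := by
  have htrans {k l : ℕ} (hkl : k < l) : Relation.TransGen S.Step (b k) (b l) := by
    induction l, hkl using Nat.le_induction with
    | base => exact .single (hb k)
    | succ l _ ih => exact .tail ih (hb l)
  refine .of_lt_imp_ne fun k l hkl h => S.no_periodic (b k) ?_
  simpa only [← h] using htrans hkl

variable (hinv : ∀ x y, S.Step x y → (x ∈ K ↔ y ∈ K)) (hb : ∀ k, S.Step (b k) (b (k + 1)))
  (hb0 : b 0 ∈ K)
include hinv hb hb0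

theorem orbit_mem (k : ℕ) : b k ∈ K := by
  induction k with
  | zero => exact hb0
  | succ k ih => exact (hinv _ _ (hb k)).1 ih

/-- Two gaps of an orbit with the same label and orientation cannot share a singular point, because
one of them would then contain the orbit point next to the other. -/
theorem finite_setOf_singular_gap (v : ℝ) :
    {k | ∃ r > 0, S.IsGap K (b k) ((-1) ^ k * v) r ∧
      (b k).2 + r * ((-1) ^ k * v) ∈ S.dom (b k).1 ∧
      ∀ y, ¬ S.Step ((b k).1, (b k).2 + r * ((-1) ^ k * v)) y}.Finite := by
  choose! r hr0 hgap hdom hsingular using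
    fun k (hk : k ∈ {k | ∃ r > 0, S.IsGap K (b k) ((-1) ^ k * v) r ∧
      (b k).2 + r * ((-1) ^ k * v) ∈ S.dom (b k).1 ∧
      ∀ y, ¬ S.Step ((b k).1, (b k).2 + r * ((-1) ^ k * v)) y}) => hk
  refine Set.Finite.of_finite_image (f := fun k =>
    (((b k).1, (b k).2 + r k * ((-1) ^ k * v)), (-1) ^ k * v)) ?_ ?_
  · refine (S.finite_no_image.prod (toFinite {v, -v})).subset ?_
    rintro _ ⟨k, hk, rfl⟩
    refine ⟨⟨hdom k hk, hsingular k hk⟩, ?_⟩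
    rcases neg_one_pow_eq_or ℝ k with h | h <;> simp [h]
  · intro k hk l hl hkl
    simp only [Prod.mk.injEq] at hkl
    obtain ⟨⟨hlabel, hsum⟩, hdir⟩ := hkl
    rw [hdir] at hsum
    have hne {k l} (hk : k ∈ _) (hl : l ∈ _) (hlabel : (b k).1 = (b l).1)
        (hsum : (b k).2 + r k * ((-1) ^ l * v) = (b l).2 + r l * ((-1) ^ l * v)) : ¬ r k < r l :=
      fun hlt => (hgap l hl).ne (orbit_mem hinv hb hb0 k) hlabel
        ⟨sub_pos.2 hlt, by linarith [hr0 k hk]⟩ (by linear_combination hsum)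
    have hr : r k = r l := le_antisymm (not_lt.1 (hne hl hk hlabel.symm (by rw [hdir, hsum])))
      (not_lt.1 (hne hk hl hlabel hsum))
    rw [hr] at hsum
    exact orbit_injective hb (Prod.ext hlabel (add_right_cancel hsum))

theorem exists_uniform_gap (hs : 0 < s) (hgap : S.IsGap K (b 0) v s) :
    ∃ N, ∃ t > 0, ∀ k ≥ N, S.IsGap K (b k) ((-1) ^ k * v) t := by
  have hexists (k : ℕ) : ∃ t > 0, S.IsGap K (b k) ((-1) ^ k * v) t := by
    induction k with
    | zero => exact ⟨s, hs, by simpa using hgap⟩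
    | succ k ih =>
      obtain ⟨t, ht, hgap⟩ := ih
      simpa only [pow_succ', neg_mul, one_mul] using hgap.exists_map hinv ht (hb k)
  obtain ⟨N, hN⟩ := (finite_setOf_singular_gap hinv hb hb0 v).bddAbove
  obtain ⟨t, ht, hgap⟩ := hexists (N + 1)
  refine ⟨N + 1, t, ht, fun k hk => ?_⟩
  induction k, hk using Nat.le_induction with
  | base => exact hgap
  | succ k hk ih =>
    rw [pow_succ', neg_one_mul, neg_mul]
    refine ih.map hinv (hb k) fun r hr => ?_
    by_contra! hno
    have : k ≤ N := hN ⟨r, hr.1, ih.mono hr.2.le, (ih r hr).1, hno⟩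
    omega

/-- The gaps that accompany an orbit would eventually have a common length, and then two of them
with the same label and orientation overlap, because the intervals are bounded. -/
theorem not_isGap_of_orbit [Finite α] (hv : v ≠ 0) (hs : 0 < s) : ¬ S.IsGap K (b 0) v s := by
  intro hgap
  obtain ⟨N, t, ht, hgap⟩ := exists_uniform_gap hinv hb hb0 hs hgap
  have hδ : 0 < t * |v| := mul_pos ht (abs_pos.2 hv)
  obtain ⟨C, hC⟩ := (Bornology.isBounded_iUnion.2 S.isBounded_dom).exists_norm_le
  have hmaps : MapsTo (fun k => ((b k).1, (-1) ^ k * v, ⌊(b k).2 / (t * |v|)⌋)) (Ici N)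
      (univ ×ˢ ({v, -v} : Set ℝ) ×ˢ Icc ⌊-C / (t * |v|)⌋ ⌊C / (t * |v|)⌋) := by
    intro k _
    have hbound := abs_le.1 (hC _ (mem_iUnion_of_mem _ (S.mem_left (hb k))))
    refine ⟨mem_univ _, ?_, Int.floor_le_floor ?_, Int.floor_le_floor ?_⟩
    rotate_left
    · exact div_le_div_of_nonneg_right hbound.1 hδ.le
    · exact div_le_div_of_nonneg_right hbound.2 hδ.le
    rcases neg_one_pow_eq_or ℝ k with h | h <;> simp [h]
  obtain ⟨k, hk, l, hl, hne, hkl⟩ := (Ici_infinite N).exists_ne_map_eq_of_mapsTo hmaps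
    (finite_univ.prod ((toFinite _).prod (finite_Icc _ _)))
  simp only [Prod.mk.injEq] at hkl
  obtain ⟨hlabel, hdir, hfloor⟩ := hkl
  have hclose := Int.abs_sub_lt_one_of_floor_eq_floor hfloor
  rw [← sub_div, abs_div, abs_of_pos hδ, div_lt_one hδ] at hclose
  have hvl : (-1) ^ l * v ≠ 0 := mul_ne_zero (by simp) hv
  set r : ℝ := ((b k).2 - (b l).2) / ((-1) ^ l * v) with hr
  have hrv : r * ((-1) ^ l * v) = (b k).2 - (b l).2 := div_mul_cancel₀ _ hvl
  have hrt : |r| < t := by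
    rw [hr, abs_div, div_lt_iff₀ (abs_pos.2 hvl)]
    simpa [abs_mul] using hclose
  have hmem := orbit_mem hinv hb hb0
  rcases lt_trichotomy r 0 with h | h | h
  · exact (hgap k hk).ne (hmem l) hlabel.symm (r := -r) ⟨neg_pos.2 h, (neg_le_abs r).trans_lt hrt⟩
      (by rw [hdir]; linear_combination hrv)
  · rw [h, zero_mul] at hrv
    exact hne (orbit_injective hb (Prod.ext hlabel (sub_eq_zero.1 hrv.symm)))
  · exact (hgap l hl).ne (hmem k) hlabel ⟨h, (le_abs_self r).trans_lt hrt⟩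
      (by linear_combination -hrv)

end Orbit

theorem not_isGap [Finite α] (hinv : ∀ x y, S.Step x y → (x ∈ K ↔ y ∈ K)) (hx : x ∈ K)
    (hdom : x.2 ∈ S.dom x.1) (hv : v ≠ 0) (hs : 0 < s) : ¬ S.IsGap K x v s := by
  intro hgap
  by_cases hforward : ∀ y, Relation.ReflTransGen S.Step x y → ∃ z, S.Step y z
  · obtain ⟨b, rfl, hb⟩ := exists_orbit hforward
    exact not_isGap_of_orbit hinv hb hx hv hs hgap
  by_cases hbackward :
      ∀ y, Relation.ReflTransGen S.inverse.Step x y → ∃ z, S.inverse.Step y z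
  · obtain ⟨b, rfl, hb⟩ := exists_orbit hbackward
    exact not_isGap_of_orbit (S := S.inverse) (fun x y h => (hinv y x h).symm) hb hx hv hs hgap
  push Not at hforward hbackward
  obtain ⟨y, hxy, hy⟩ := hforward
  obtain ⟨w, hxw, hw⟩ := hbackward
  have hwx : Relation.ReflTransGen S.Step w x := Relation.reflTransGen_swap.1 hxw
  have hwdom : w.2 ∈ S.dom w.1 := by
    rcases hwx.cases_head with rfl | ⟨z, hwz, -⟩
    exacts [hdom, S.mem_left hwz]
  exact (S.no_connection hwdom hw (hwx.trans hxy)).elim hy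

theorem mem_of_isClosed_fiber [Finite α] (hinv : ∀ x y, S.Step x y → (x ∈ K ↔ y ∈ K)) {a : α}
    (hclosed : IsClosed {t | (a, t) ∈ K}) {s t : ℝ} (hs : s ∈ S.dom a) (hsK : (a, s) ∈ K)
    (ht : t ∈ S.dom a) : (a, t) ∈ K := by
  by_contra htK
  let times : Set ℝ := Icc 0 1 ∩ (fun r => s + r * (t - s)) ⁻¹' {t | (a, t) ∈ K}
  have hcompact : IsCompact times := isCompact_Icc.inter_right (hclosed.preimage (by fun_prop))
  obtain ⟨r₀, ⟨⟨hr₀, hr₀'⟩, hr₀K⟩, hmax⟩ := hcompact.exists_isGreatest ⟨0, by simp, by simpa⟩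
  have hr₀_lt : r₀ < 1 := hr₀'.lt_of_ne (by rintro rfl; exact htK (by simpa using hr₀K))
  have hdom (r : ℝ) (hr : r ∈ Icc 0 1) : s + r * (t - s) ∈ S.dom a := by
    simpa using (S.convex_dom a).add_smul_sub_mem hs ht hr
  refine not_isGap hinv (x := (a, s + r₀ * (t - s))) hr₀K (hdom r₀ ⟨hr₀, hr₀'⟩) (v := t - s)
    (sub_ne_zero.2 ?_) (sub_pos.2 hr₀_lt) fun r hr => ?_
  · rintro rfl
    exact htK hsK
  have hmem : r₀ + r ∈ Icc (0 : ℝ) 1 := ⟨by linarith [hr.1], by linarith [hr.2]⟩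
  rw [add_assoc, ← add_mul]
  exact ⟨hdom _ hmem, fun h => absurd (hmax ⟨hmem, h⟩) (by linarith [hr.1])⟩

theorem mem_closure_fiber_of_step {O O' : Set (α × ℝ)}
    (hO : ∀ x y, S.Step x y → x ∈ O → y ∈ O') (hxy : S.Step x y)
    (hx : x.2 ∈ closure {t | (x.1, t) ∈ O}) : y.2 ∈ closure {t | (y.1, t) ∈ O'} := by
  rw [mem_closure_iff_frequently, ← map_add_left_nhds_zero, frequently_map] at hx
  have hflip : Tendsto (fun h => y.2 - h) (𝓝 0) (𝓝 y.2) := by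
    simpa using (tendsto_id (α := ℝ) (x := 𝓝 0)).const_sub y.2
  refine mem_closure_iff_frequently.2 (hflip.frequently (hx.mp ?_))
  filter_upwards [S.isometry hxy] with h hstep
  exact hO _ _ hstep

theorem dom_subset_closure [Finite α] {O : Set (α × ℝ)}
    (hinv : ∀ x y, S.Step x y → (x ∈ O ↔ y ∈ O)) {a : α} {s : ℝ} (hs : s ∈ S.dom a)
    (hsO : (a, s) ∈ O) : S.dom a ⊆ closure {t | (a, t) ∈ O} := by
  let K : Set (α × ℝ) := {x | x.2 ∈ closure {t | (x.1, t) ∈ O}}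
  have hK (x y) (hxy : S.Step x y) : x ∈ K ↔ y ∈ K :=
    ⟨mem_closure_fiber_of_step (fun x y h => (hinv x y h).1) hxy,
      mem_closure_fiber_of_step (S := S.inverse) (fun x y h => (hinv y x h).2) hxy⟩
  have hclosed : IsClosed {t | (a, t) ∈ K} := by simp [K]
  exact fun t ht => mem_of_isClosed_fiber hK hclosed hs (subset_closure hsO) ht

variable (S) in
/-- The exchange without the step that leads to `x₀`. The forward orbit of `x₀` is invariant under
this exchange, but it need not be invariant under the original one. -/
def cut (x₀ : α × ℝ) (hforward : ∀ y, Relation.ReflTransGen S.Step x₀ y → ∃ z, S.Step y z)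
    (hbackward : ∀ y, Relation.ReflTransGen S.Step y x₀ → ∃ z, S.Step z y) :
    FlippedIntervalExchange α where
  dom := S.dom
  Step x y := S.Step x y ∧ y ≠ x₀
  convex_dom := S.convex_dom
  isOpen_dom := S.isOpen_dom
  isBounded_dom := S.isBounded_dom
  mem_left h := S.mem_left h.1
  mem_right h := S.mem_right h.1
  right_unique h h' := S.right_unique h.1 h'.1
  left_unique h h' := S.left_unique h.1 h'.1
  isometry {x y} hxy := by
    let : TopologicalSpace α := ⊥
    have := discreteTopology_bot α
    have hcont : Continuous fun h : ℝ => (y.1, y.2 - h) := by fun_prop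
    have hne : ∀ᶠ h in 𝓝 (0 : ℝ), (y.1, y.2 - h) ≠ x₀ :=
      hcont.continuousAt.eventually_ne (by simpa using hxy.2)
    exact (S.isometry hxy.1).and hne
  finite_no_image := by
    have hx₀ : {x | S.Step x x₀}.Subsingleton := fun x hx y hy => S.left_unique hx hy
    refine (S.finite_no_image.union hx₀.finite).subset fun x hx => ?_
    by_cases hstep : S.Step x x₀
    · exact .inr hstep
    · exact .inl ⟨hx.1, fun y hxy => hx.2 y ⟨hxy, by rintro rfl; exact hstep hxy⟩⟩
  finite_no_preimage := by
    refine (S.finite_no_preimage.insert x₀).subset fun x hx => ?_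
    rw [mem_insert_iff, or_iff_not_imp_left]
    exact fun hne => ⟨hx.1, fun y hyx => hx.2 y ⟨hyx, hne⟩⟩
  no_connection {x y} hx hno hxy := by
    replace hxy : Relation.ReflTransGen S.Step x y := hxy.lift id fun _ _ h => h.1
    by_cases hxx₀ : x = x₀
    · subst hxx₀
      obtain ⟨z, hyz⟩ := hforward y hxy
      exact ⟨z, hyz, by rintro rfl; exact S.no_periodic _ (.tail' hxy hyz)⟩
    · replace hno : ∀ w, ¬ S.Step w x := fun w hw => hno w ⟨hw, hxx₀⟩
      obtain ⟨z, hyz⟩ := S.no_connection hx hno hxy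
      refine ⟨z, hyz, ?_⟩
      rintro rfl
      obtain ⟨w, hw⟩ := hbackward x (hxy.tail hyz)
      exact hno w hw
  no_periodic x h := S.no_periodic x (h.lift id fun _ _ h => h.1)

theorem finite_orbit_sdiff (hxy : Relation.ReflTransGen S.Step x y) :
    ({z | Relation.ReflTransGen S.Step x z} \ {z | Relation.TransGen S.Step y z}).Finite := by
  induction hxy using Relation.ReflTransGen.head_induction_on with
  | refl =>
    refine (finite_singleton y).subset fun z hz => ?_
    exact (Relation.reflTransGen_iff_eq_or_transGen.1 hz.1).resolve_right hz.2
  | @head x w hxw _ ih =>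
    refine (ih.insert x).subset fun z ⟨hxz, hyz⟩ => ?_
    rcases hxz.cases_head with rfl | ⟨w', hxw', hw'z⟩
    · exact mem_insert _ _
    · rw [S.right_unique hxw' hxw] at hw'z
      exact .inr ⟨hw'z, hyz⟩

theorem subset_closure_of_sdiff_finite {U F G : Set ℝ} (hU : IsOpen U) (hF : U ⊆ closure F)
    (hFG : (F \ G).Finite) : U ⊆ closure G := by
  have hfinite : (U \ closure G).Finite := by
    refine hFG.subset fun t ht => ?_
    have : t ∈ closure (F \ G) ∪ closure G := by
      rw [← closure_union, sdiff_union_self]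
      exact closure_mono subset_union_left (hF ht.1)
    exact hFG.isClosed.closure_eq ▸ this.resolve_right ht.2
  intro t ht
  by_contra htG
  exact infinite_of_mem_nhds t ((hU.sdiff isClosed_closure).mem_nhds ⟨ht, htG⟩) hfinite

/-- If the past of `x` ends in a point, then the forward orbit of that point is invariant.
Otherwise the forward orbit of `x` is invariant after the step to `x` has been removed. -/
theorem exists_dom_subset_closure_orbit [Finite α]
    (hforward : ∀ y, Relation.ReflTransGen S.Step x y → ∃ z, S.Step y z) :
    ∃ w, Relation.ReflTransGen S.Step w x ∧ ∀ y, Relation.ReflTransGen S.Step w y →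
      y.2 ∈ S.dom y.1 → S.dom y.1 ⊆ closure {t | Relation.ReflTransGen S.Step w (y.1, t)} := by
  by_cases hbackward : ∀ y, Relation.ReflTransGen S.Step y x → ∃ z, S.Step z y
  · refine ⟨x, .refl, fun y hxy hy => ?_⟩
    refine dom_subset_closure (S := S.cut x hforward hbackward)
      (O := {z | Relation.ReflTransGen S.Step x z}) (fun z z' hzz' => ?_) hy hxy
    refine ⟨fun hxz => hxz.tail hzz'.1, fun hxz' => ?_⟩
    rcases hxz'.cases_tail with h | ⟨z'', hxz'', hz''⟩
    · exact absurd h hzz'.2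
    · rwa [S.left_unique hzz'.1 hz'']
  · push Not at hbackward
    obtain ⟨w, hwx, hw⟩ := hbackward
    refine ⟨w, hwx, fun y hwy hy => ?_⟩
    refine dom_subset_closure
      (O := {z | Relation.ReflTransGen S.Step w z}) (fun z z' hzz' => ?_) hy hwy
    refine ⟨fun hwz => hwz.tail hzz', fun hwz' => ?_⟩
    rcases hwz'.cases_tail with rfl | ⟨z'', hwz'', hz''⟩
    · exact absurd hzz' (hw z)
    · rwa [S.left_unique hzz' hz'']

theorem dom_subset_closure_orbit [Finite α]
    (hforward : ∀ y, Relation.ReflTransGen S.Step x y → ∃ z, S.Step y z)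
    (hxy : Relation.ReflTransGen S.Step x y) :
    S.dom y.1 ⊆ closure {t | Relation.TransGen S.Step x (y.1, t)} := by
  obtain ⟨w, hwx, hdense⟩ := exists_dom_subset_closure_orbit hforward
  obtain ⟨z, hyz⟩ := hforward y hxy
  refine subset_closure_of_sdiff_finite (S.isOpen_dom _)
    (hdense y (hwx.trans hxy) (S.mem_left hyz)) ?_
  exact (finite_orbit_sdiff hwx).preimage (f := Prod.mk y.1) (Prod.mk_right_injective y.1).injOn

end FlippedIntervalExchange

/-! ### Geometry of the table -/

attribute [local instance] Complex.finrank_real_complex_fact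

/-- The signed area of the parallelogram spanned by two vectors of the plane. -/
noncomputable def wedge : ℂ →ₗ[ℝ] ℂ →ₗ[ℝ] ℝ := Complex.orientation.areaForm

theorem wedge_apply (u z : ℂ) : wedge u z = u.re * z.im - u.im * z.re := by
  simp [wedge, Complex.areaForm, sub_eq_add_neg]

theorem wedge_self (u : ℂ) : wedge u u = 0 := Complex.orientation.areaForm_apply_self u

theorem wedge_swap (u z : ℂ) : wedge u z = -wedge z u := Complex.orientation.areaForm_swap u z

theorem continuous_wedge (u : ℂ) : Continuous (wedge u) :=
  (wedge u).continuous_of_finiteDimensional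

theorem im_div_eq_wedge_div (u z : ℂ) : (z / u).im = wedge u z / Complex.normSq u := by
  rw [Complex.div_im, wedge_apply]
  ring

theorem exists_smul_of_wedge_eq_zero {u z : ℂ} (hu : u ≠ 0) (h : wedge u z = 0) :
    ∃ t : ℝ, z = t • u := by
  have him : (z / u).im = 0 := by rw [im_div_eq_wedge_div, h, zero_div]
  refine ⟨(z / u).re, ?_⟩
  rw [Complex.real_smul, Complex.conj_eq_iff_re.1 (Complex.conj_eq_iff_im.2 him),
    div_mul_cancel₀ z hu]

namespace PolygonalBilliard

variable (P : PolygonalBilliard)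

instance : NeZero P.n := ⟨by have := P.three_le; omega⟩

/-- The vector along the `i`-th side. -/
def sideVec (i : ZMod P.n) : ℂ := P.vertex (i + 1) - P.vertex i

theorem sideVec_ne_zero (i : ZMod P.n) : P.sideVec i ≠ 0 :=
  sub_ne_zero.2 (P.vertex_ne_succ i).symm

variable {P} {i j : ZMod P.n} {z w m u : ℂ}

theorem mem_openSide_iff :
    z ∈ P.openSide i ↔ ∃ t ∈ Ioo (0 : ℝ) 1, z = P.vertex i + t • P.sideVec i := by
  simp only [openSide, openSegment_eq_image', mem_image, sideVec, eq_comm]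

theorem nonempty_openSide (P : PolygonalBilliard) (i : ZMod P.n) : (P.openSide i).Nonempty :=
  ⟨_, mem_openSide_iff.2 ⟨1 / 2, by norm_num, rfl⟩⟩

theorem side_subset_frontier :
    segment ℝ (P.vertex i) (P.vertex (i + 1)) ⊆ frontier P.table := by
  rw [P.frontier_table]
  exact subset_iUnion (fun i => segment ℝ (P.vertex i) (P.vertex (i + 1))) i

theorem openSide_subset_frontier : P.openSide i ⊆ frontier P.table :=
  (openSegment_subset_segment ℝ _ _).trans side_subset_frontier

theorem frontier_subset_table : frontier P.table ⊆ P.table :=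
  P.isCompact_table.isClosed.frontier_subset

theorem vertex_notMem_openSide : P.vertex j ∉ P.openSide i := by
  intro h
  have hi : P.vertex j ≠ P.vertex i := fun h' =>
    P.vertex_ne_succ i (left_mem_openSegment_iff.1 (h' ▸ h))
  have hi' : P.vertex j ≠ P.vertex (i + 1) := fun h' =>
    P.vertex_ne_succ i (right_mem_openSegment_iff.1 (h' ▸ h))
  have hside := openSegment_subset_segment ℝ _ _ h
  by_cases hij : i = j + 1
  · subst hij
    have : P.vertex j ∈ ({P.vertex (j + 1)} : Set ℂ) :=
      P.side_inter_next j ▸ ⟨left_mem_segment ℝ _ _, hside⟩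
    exact hi this
  · exact disjoint_left.1 (P.side_disjoint i j (fun h => hi (h ▸ rfl)) (fun h => hi' (h ▸ rfl)) hij)
      hside (left_mem_segment ℝ _ _)

theorem mem_frontier_iff :
    z ∈ frontier P.table ↔ z ∈ range P.vertex ∨ ∃ i, z ∈ P.openSide i := by
  rw [P.frontier_table]
  constructor
  · intro h
    obtain ⟨i, hi⟩ := mem_iUnion.1 h
    rw [← insert_endpoints_openSegment] at hi
    rcases hi with rfl | rfl | hi
    exacts [.inl ⟨i, rfl⟩, .inl ⟨i + 1, rfl⟩, .inr ⟨i, hi⟩]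
  · rintro (⟨i, rfl⟩ | ⟨i, hi⟩)
    exacts [mem_iUnion_of_mem i (left_mem_segment ℝ _ _),
      mem_iUnion_of_mem i (openSegment_subset_segment ℝ _ _ hi)]

theorem eventually_mem_openSide_of_mem_frontier (hz : z ∈ P.openSide i) :
    ∀ᶠ w in 𝓝 z, w ∈ frontier P.table → w ∈ P.openSide i := by
  have hvertices : ∀ᶠ w in 𝓝 z, w ∉ range P.vertex := by
    refine (finite_range P.vertex).isClosed.isOpen_compl.mem_nhds ?_
    rintro ⟨j, rfl⟩
    exact vertex_notMem_openSide hz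
  have hsides : ∀ᶠ w in 𝓝 z, ∀ j ≠ i, w ∉ segment ℝ (P.vertex j) (P.vertex (j + 1)) := by
    refine eventually_all.2 fun j => eventually_imp_distrib_left.2 fun hji => ?_
    have hclosed := closure_openSegment (𝕜 := ℝ) (P.vertex j) (P.vertex (j + 1)) ▸ isClosed_closure
    refine hclosed.isOpen_compl.mem_nhds fun hzj => ?_
    rw [← insert_endpoints_openSegment] at hzj
    rcases hzj with rfl | rfl | hzj
    exacts [vertex_notMem_openSide hz, vertex_notMem_openSide hz, hji (P.openSide_unique hzj hz)]
  filter_upwards [hvertices, hsides] with w hv hs hw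
  obtain ⟨j, hj⟩ := (mem_frontier_iff.1 hw).resolve_left hv
  by_cases hji : j = i
  exacts [hji ▸ hj, absurd (openSegment_subset_segment ℝ _ _ hj) (hs j hji)]

theorem wedge_sideVec_eq_zero (hz : z ∈ P.openSide i) :
    wedge (P.sideVec i) (z - P.vertex i) = 0 := by
  obtain ⟨t, -, rfl⟩ := mem_openSide_iff.1 hz
  rw [add_sub_cancel_left, map_smul, wedge_self, smul_zero]

theorem eventually_mem_openSide_of_wedge_eq_zero (hz : z ∈ P.openSide i) :
    ∀ᶠ w in 𝓝 z, wedge (P.sideVec i) (w - P.vertex i) = 0 → w ∈ P.openSide i := by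
  have hd := P.sideVec_ne_zero i
  have hre (t : ℝ) : ((P.vertex i + t • P.sideVec i - P.vertex i) / P.sideVec i).re = t := by
    rw [add_sub_cancel_left, Complex.real_smul, mul_div_cancel_right₀ _ hd, Complex.ofReal_re]
  have hcont : Continuous fun w => ((w - P.vertex i) / P.sideVec i).re := by fun_prop
  obtain ⟨t, ht, rfl⟩ := mem_openSide_iff.1 hz
  filter_upwards [hcont.continuousAt.preimage_mem_nhds
    (isOpen_Ioo.mem_nhds ((hre t).symm ▸ ht))] with w hw hwedge
  obtain ⟨s, hs⟩ := exists_smul_of_wedge_eq_zero hd hwedge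
  obtain rfl : w = P.vertex i + s • P.sideVec i := by rw [← hs, add_sub_cancel]
  exact mem_openSide_iff.2 ⟨s, by simpa only [mem_preimage, hre] using hw, rfl⟩

/-- Near `z` the boundary lies on the line of the side, so a half disk at `z` is a connected set
that does not meet the boundary. -/
theorem eventually_mem_interior_or_notMem_table (hz : z ∈ P.openSide i) {f : ℂ →ₗ[ℝ] ℝ}
    (hf : ∀ w ∈ P.openSide i, f (w - P.vertex i) = 0) :
    (∀ᶠ w in 𝓝 z, 0 < f (w - P.vertex i) → w ∈ interior P.table) ∨
      ∀ᶠ w in 𝓝 z, 0 < f (w - P.vertex i) → w ∉ P.table := by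
  obtain ⟨r, hr, hball⟩ :=
    Metric.eventually_nhds_iff_ball.1 (eventually_mem_openSide_of_mem_frontier hz)
  let H : Set ℂ := Metric.ball z r ∩ {w | 0 < f (w - P.vertex i)}
  have hHconvex : Convex ℝ H := by
    refine (convex_ball z r).inter ?_
    simpa only [map_sub, sub_pos] using convex_halfSpace_gt f.isLinear (f (P.vertex i))
  have hcover : H ⊆ interior P.table ∪ P.tableᶜ := by
    rintro w ⟨hw, hpos⟩
    by_contra! h
    rw [mem_union, not_or, mem_compl_iff, not_not] at h
    exact (ne_of_gt hpos) (hf w (hball w hw ⟨subset_closure h.2, h.1⟩))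
  have heventually {S : Set ℂ} (hS : H ⊆ S) : ∀ᶠ w in 𝓝 z, 0 < f (w - P.vertex i) → w ∈ S :=
    by
    filter_upwards [Metric.ball_mem_nhds z hr] with w hw hpos using hS ⟨hw, hpos⟩
  exact (hHconvex.isPreconnected.subset_or_subset isOpen_interior
    P.isCompact_table.isClosed.isOpen_compl (disjoint_compl_right.mono_left interior_subset)
    hcover).imp heventually (heventually (S := P.tableᶜ))

theorem frequently_mem_interior (hz : z ∈ P.table) : ∃ᶠ w in 𝓝 z, w ∈ interior P.table :=
  mem_closure_iff_frequently.1 (P.closure_interior_table.symm ▸ hz)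

variable (P) in
/-- `f` is positive exactly on the table's side of the line through the `i`-th side, as seen from
the points near `z`. -/
def IsInwardAt (i : ZMod P.n) (f : ℂ →ₗ[ℝ] ℝ) (z : ℂ) : Prop :=
  ∀ᶠ w in 𝓝 z, w ∈ interior P.table ↔ 0 < f (w - P.vertex i)

theorem isInwardAt_of_eventually {f : ℂ →ₗ[ℝ] ℝ} (hz : z ∈ P.openSide i)
    (hf : f = wedge (P.sideVec i) ∨ f = -wedge (P.sideVec i))
    (hpos : ∀ᶠ w in 𝓝 z, 0 < f (w - P.vertex i) → w ∈ interior P.table)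
    (hneg : ∀ᶠ w in 𝓝 z, f (w - P.vertex i) < 0 → w ∉ P.table) : P.IsInwardAt i f z := by
  filter_upwards [hpos, hneg, eventually_mem_openSide_of_wedge_eq_zero hz] with w hp hn h0
  refine ⟨fun hw => not_le.1 fun h => ?_, hp⟩
  rcases h.lt_or_eq with h | h
  · exact hn h (interior_subset hw)
  · have hwedge : wedge (P.sideVec i) (w - P.vertex i) = 0 := by
      rcases hf with rfl | rfl <;> simpa only [LinearMap.neg_apply, neg_eq_zero] using h
    exact (openSide_subset_frontier (h0 hwedge)).2 hw

theorem exists_isInwardAt (hz : z ∈ P.openSide i) :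
    P.IsInwardAt i (wedge (P.sideVec i)) z ∨ P.IsInwardAt i (-wedge (P.sideVec i)) z := by
  set f := wedge (P.sideVec i) with hf
  have hzero : ∀ w ∈ P.openSide i, f (w - P.vertex i) = 0 := fun w => wedge_sideVec_eq_zero
  have hzf := openSide_subset_frontier hz
  have hside := eventually_mem_openSide_of_wedge_eq_zero hz
  have hneg := eventually_mem_interior_or_notMem_table hz (f := -f) fun w hw => by
    rw [LinearMap.neg_apply, hzero w hw, neg_zero]
  simp only [LinearMap.neg_apply, neg_pos] at hneg
  rcases eventually_mem_interior_or_notMem_table hz hzero with hpos | hpos <;>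
    rcases hneg with hneg | hneg
  · have hout : ∃ᶠ w in 𝓝 z, w ∉ P.table :=
      (mem_closure_iff_frequently (s := P.tableᶜ)).1 (by rw [closure_compl]; exact hzf.2)
    refine absurd hout (not_frequently.2 ?_)
    filter_upwards [hpos, hneg, hside] with w hp hn h0
    rw [not_not]
    rcases lt_trichotomy (f (w - P.vertex i)) 0 with h | h | h
    exacts [interior_subset (hn h), frontier_subset_table (openSide_subset_frontier (h0 h)),
      interior_subset (hp h)]
  · exact .inl (isInwardAt_of_eventually hz (.inl hf) hpos hneg)
  · refine .inr (isInwardAt_of_eventually hz (.inr rfl) ?_ ?_) <;>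
      simpa only [LinearMap.neg_apply, neg_pos, neg_lt_zero]
  · refine absurd (frequently_mem_interior (frontier_subset_table hzf)) (not_frequently.2 ?_)
    filter_upwards [hpos, hneg, hside] with w hp hn h0
    rcases lt_trichotomy (f (w - P.vertex i)) 0 with h | h | h
    exacts [fun hw => hn h (interior_subset hw), fun hw => (openSide_subset_frontier (h0 h)).2 hw,
      fun hw => hp h (interior_subset hw)]

theorem exists_inward (i : ZMod P.n) : ∃ f : ℂ →ₗ[ℝ] ℝ,
    (f = wedge (P.sideVec i) ∨ f = -wedge (P.sideVec i)) ∧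
      ∀ z ∈ P.openSide i, P.IsInwardAt i f z := by
  set f := wedge (P.sideVec i)
  have hopen (f) : IsOpen {z | P.IsInwardAt i f z} := isOpen_setOfPred_eventually_nhds
  by_cases hall : P.openSide i ⊆ {z | P.IsInwardAt i f z}
  · exact ⟨f, .inl rfl, hall⟩
  refine ⟨-f, .inr rfl, ?_⟩
  have hcover : P.openSide i ⊆ {z | P.IsInwardAt i (-f) z} ∪ {z | P.IsInwardAt i f z} :=
    fun z hz => (exists_isInwardAt hz).symm
  obtain ⟨z, hz, hzf⟩ := not_subset.1 hall
  have hpre : IsPreconnected (P.openSide i) := (convex_openSegment _ _).isPreconnected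
  by_contra hnot
  obtain ⟨w, hw, hwf⟩ := not_subset.1 hnot
  obtain ⟨x, hx, hx', hx''⟩ := hpre _ _ (hopen _) (hopen _) hcover
    ⟨z, hz, (hcover hz).resolve_right hzf⟩ ⟨w, hw, (hcover hw).resolve_left hwf⟩
  refine absurd (frequently_mem_interior (frontier_subset_table (openSide_subset_frontier hx)))
    (not_frequently.2 ?_)
  filter_upwards [hx', hx''] with v hv hv' hvt
  have h1 := hv.1 hvt
  have h2 := hv'.1 hvt
  rw [LinearMap.neg_apply] at h1
  linarith

variable (P) in
/-- The linear form that vanishes on the `i`-th side and is positive on the directions that point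
from it into the table. -/
noncomputable def inward (i : ZMod P.n) : ℂ →ₗ[ℝ] ℝ := (exists_inward i).choose

theorem inward_eq (i : ZMod P.n) :
    P.inward i = wedge (P.sideVec i) ∨ P.inward i = -wedge (P.sideVec i) :=
  (exists_inward i).choose_spec.1

theorem eventually_mem_interior_iff (hz : z ∈ P.openSide i) :
    ∀ᶠ w in 𝓝 z, w ∈ interior P.table ↔ 0 < P.inward i (w - P.vertex i) :=
  (exists_inward i).choose_spec.2 z hz

theorem inward_eq_zero_iff : P.inward i u = 0 ↔ wedge (P.sideVec i) u = 0 := by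
  rcases inward_eq (P := P) i with h | h <;> simp [h]

theorem inward_sideVec : P.inward i (P.sideVec i) = 0 := inward_eq_zero_iff.2 (wedge_self _)

theorem inward_sub_vertex (hz : z ∈ P.openSide i) : P.inward i (z - P.vertex i) = 0 :=
  inward_eq_zero_iff.2 (wedge_sideVec_eq_zero hz)

theorem eventually_mem_openSide (hz : z ∈ P.openSide i) :
    ∀ᶠ w in 𝓝 z, P.inward i (w - P.vertex i) = 0 → w ∈ P.openSide i := by
  simpa only [inward_eq_zero_iff] using eventually_mem_openSide_of_wedge_eq_zero hz

theorem continuous_inward : Continuous (P.inward i) :=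
  (P.inward i).continuous_of_finiteDimensional

theorem tendsto_add_smul (z u : ℂ) (τ : ℝ) :
    Tendsto (fun s : ℝ => z + s • u) (𝓝 τ) (𝓝 (z + τ • u)) := by
  have : Continuous fun s : ℝ => z + s • u := by fun_prop
  exact this.tendsto τ

theorem eventually_add_smul_mem_interior_iff (hz : z ∈ P.openSide i) (u : ℂ) :
    ∀ᶠ s in 𝓝 (0 : ℝ), z + s • u ∈ interior P.table ↔ 0 < s * P.inward i u := by
  have hline := tendsto_add_smul z u 0
  rw [zero_smul, add_zero] at hline
  filter_upwards [hline.eventually (eventually_mem_interior_iff hz)] with s hs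
  rw [hs, add_sub_right_comm, map_add, inward_sub_vertex hz, zero_add, map_smul, smul_eq_mul]

variable (P) in
/-- A billiard ball that leaves `z` in the direction `u` moves freely in the interior of the table
until it reaches `w`. -/
def Flight (u z w : ℂ) : Prop :=
  ∃ τ > 0, w = z + τ • u ∧ ∀ s ∈ Ioo (0 : ℝ) τ, z + s • u ∈ interior P.table

theorem Flight.symm (h : P.Flight u z w) : P.Flight (-u) w z := by
  obtain ⟨τ, hτ, rfl, hinside⟩ := h
  refine ⟨τ, hτ, by rw [smul_neg, add_neg_cancel_right], fun s hs => ?_⟩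
  convert hinside (τ - s) ⟨sub_pos.2 hs.2, sub_lt_self τ hs.1⟩ using 1
  module

theorem Flight.trans (h : P.Flight u z m) (hm : m ∈ interior P.table) (h' : P.Flight u m w) :
    P.Flight u z w := by
  obtain ⟨τ, hτ, rfl, hinside⟩ := h
  obtain ⟨σ, hσ, rfl, hinside'⟩ := h'
  refine ⟨τ + σ, by positivity, by module, fun s hs => ?_⟩
  rcases lt_trichotomy s τ with hsτ | rfl | hsτ
  · exact hinside s ⟨hs.1, hsτ⟩
  · exact hm
  · convert hinside' (s - τ) ⟨sub_pos.2 hsτ, by linarith [hs.2]⟩ using 1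
    module

theorem Flight.exists_mid (h : P.Flight u z w) :
    ∃ m ∈ interior P.table, P.Flight u z m ∧ P.Flight u m w := by
  obtain ⟨τ, hτ, rfl, hinside⟩ := h
  refine ⟨z + (τ / 2) • u, hinside _ ⟨by positivity, by linarith⟩,
    ⟨τ / 2, by positivity, rfl, fun s hs => hinside s ⟨hs.1, by linarith [hs.2]⟩⟩,
    ⟨τ / 2, by positivity, by module, fun s hs => ?_⟩⟩
  rw [add_assoc, ← add_smul]
  exact hinside _ ⟨by linarith [hs.1], by linarith [hs.2]⟩

theorem Flight.right_unique (h : P.Flight u z w) (h' : P.Flight u z m)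
    (hw : w ∈ frontier P.table) (hm : m ∈ frontier P.table) : w = m := by
  obtain ⟨τ, hτ, rfl, hinside⟩ := h
  obtain ⟨σ, hσ, rfl, hinside'⟩ := h'
  rcases lt_trichotomy τ σ with hlt | rfl | hlt
  exacts [absurd (hinside' τ ⟨hτ, hlt⟩) hw.2, rfl, absurd (hinside σ ⟨hσ, hlt⟩) hm.2]

theorem Flight.inward_pos (h : P.Flight u z w) (hz : z ∈ P.openSide i) : 0 < P.inward i u := by
  obtain ⟨τ, hτ, -, hinside⟩ := h
  have hnear := (eventually_add_smul_mem_interior_iff hz u).filter_mono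
    (nhdsWithin_le_nhds (s := Ioi 0))
  obtain ⟨s, hiff, hs⟩ := (hnear.and (Ioo_mem_nhdsGT hτ)).exists
  exact pos_of_mul_pos_right (hiff.1 (hinside s hs)) hs.1.le

theorem Flight.inward_neg (h : P.Flight u z w) (hw : w ∈ P.openSide j) : P.inward j u < 0 := by
  simpa using h.symm.inward_pos hw

theorem exists_flight (hu : u ≠ 0) (h : ∀ᶠ s in 𝓝[>] (0 : ℝ), z + s • u ∈ interior P.table) :
    ∃ w ∈ frontier P.table, P.Flight u z w := by
  obtain ⟨δ, hδ, hstart⟩ := mem_nhdsGT_iff_exists_Ioo_subset.1 h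
  let exits : Set ℝ := {s | δ ≤ s ∧ z + s • u ∉ interior P.table}
  have hclosed : IsClosed exits := isClosed_Ici.inter
    (isOpen_interior.isClosed_compl.preimage (by fun_prop : Continuous fun s : ℝ => z + s • u))
  have hnonempty : exits.Nonempty := by
    have hfar : Tendsto (fun s : ℝ => z + s • u) atTop (Bornology.cobounded ℂ) :=
      (tendsto_const_add_cobounded z).comp (tendsto_norm_atTop_iff_cobounded.1 (by
        simpa only [norm_smul] using tendsto_norm_atTop_atTop.atTop_mul_const (norm_pos_iff.2 hu)))
    obtain ⟨s, hs, hsδ⟩ := ((hfar.eventually P.isCompact_table.isBounded.compl).and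
      (eventually_ge_atTop δ)).exists
    exact ⟨s, hsδ, fun h => hs (interior_subset h)⟩
  have hbdd : BddBelow exits := ⟨δ, fun s hs => hs.1⟩
  obtain ⟨hδτ, hout⟩ := hclosed.csInf_mem hnonempty hbdd
  set τ := sInf exits
  have hτ : 0 < τ := hδ.trans_le hδτ
  have hinside : ∀ s ∈ Ioo 0 τ, z + s • u ∈ interior P.table := by
    intro s hs
    by_contra hs'
    have hδs : δ ≤ s := not_lt.1 fun h => hs' (hstart ⟨hs.1, h⟩)
    exact notMem_of_lt_csInf hs.2 hbdd ⟨hδs, hs'⟩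
  refine ⟨z + τ • u, ⟨?_, hout⟩, τ, hτ, rfl, hinside⟩
  refine closure_mono interior_subset (mem_closure_of_tendsto
    ((tendsto_add_smul z u τ).mono_left (nhdsWithin_le_nhds (s := Iio τ))) ?_)
  filter_upwards [Ioo_mem_nhdsLT hτ] with s hs using hinside s hs

theorem exists_flight_of_mem_interior (hu : u ≠ 0) (hz : z ∈ interior P.table) :
    ∃ w ∈ frontier P.table, P.Flight u z w := by
  refine exists_flight hu (tendsto_nhdsWithin_of_tendsto_nhds ?_ |>.eventually
    (isOpen_interior.mem_nhds hz))
  simpa using tendsto_add_smul z u 0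

theorem exists_flight_of_mem_openSide (hz : z ∈ P.openSide i) (hu : 0 < P.inward i u) :
    ∃ w ∈ frontier P.table, P.Flight u z w := by
  refine exists_flight (by rintro rfl; simp at hu) ?_
  filter_upwards [(eventually_add_smul_mem_interior_iff hz u).filter_mono nhdsWithin_le_nhds,
    self_mem_nhdsWithin] with s hiff hs
  exact hiff.2 (mul_pos hs hu)

variable (P) in
/-- The time at which a ball that leaves `z` with velocity `u` meets the line through the `j`-th
side; it is `0` if `u` is parallel to that side. -/
noncomputable def sideTime (j : ZMod P.n) (u z : ℂ) : ℝ :=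
  P.inward j (z - P.vertex j) / -P.inward j u

theorem continuous_sideTime : Continuous (P.sideTime j u) := by
  have := continuous_inward (P := P) (i := j)
  unfold sideTime
  fun_prop

theorem inward_add_sideTime_smul (hu : P.inward j u ≠ 0) (z : ℂ) (c : ℝ) :
    P.inward j (z + (c * P.sideTime j u z) • u - P.vertex j) =
      (1 - c) * P.inward j (z - P.vertex j) := by
  rw [add_sub_right_comm, map_add, map_smul, smul_eq_mul, sideTime]
  field_simp
  ring

theorem sideTime_eq {τ : ℝ} (hu : P.inward j u ≠ 0) (hz : z + τ • u ∈ P.openSide j) :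
    P.sideTime j u z = τ := by
  have h0 := inward_sub_vertex hz
  rw [add_sub_right_comm, map_add, map_smul, smul_eq_mul] at h0
  rw [sideTime, div_eq_iff (neg_ne_zero.2 hu)]
  linarith

theorem tendsto_add_sideTime_smul (c : ℝ) :
    Tendsto (fun p : ℂ × ℝ => p.1 + (p.2 * P.sideTime j u p.1) • u) (𝓝 (m, c))
      (𝓝 (m + (c * P.sideTime j u m) • u)) := by
  have hτ := continuous_sideTime (P := P) (j := j) (u := u)
  have : Continuous fun p : ℂ × ℝ => p.1 + (p.2 * P.sideTime j u p.1) • u := by fun_prop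
  exact this.tendsto (m, c)

theorem Flight.sideTime_eventually_pos (h : P.Flight u m w) (hw : w ∈ P.openSide j) :
    ∀ᶠ m' in 𝓝 m, 0 < P.sideTime j u m' := by
  have hneg := h.inward_neg hw
  obtain ⟨τ, hτ, rfl, -⟩ := h
  exact continuous_sideTime.continuousAt.eventually_const_lt (sideTime_eq hneg.ne hw ▸ hτ)

theorem Flight.eventually_forall_mem_interior (h : P.Flight u m w) (hm : m ∈ interior P.table)
    (hw : w ∈ P.openSide j) : ∀ᶠ m' in 𝓝 m, ∀ c ∈ Icc (0 : ℝ) 1, c < 1 →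
      m' + (c * P.sideTime j u m') • u ∈ interior P.table := by
  have hneg := h.inward_neg hw
  have hpos := h.sideTime_eventually_pos hw
  obtain ⟨τ, hτ, rfl, hinside⟩ := h
  have hτ_m : P.sideTime j u m = τ := sideTime_eq hneg.ne hw
  refine isCompact_Icc.eventually_forall_of_forall_eventually fun c hc => ?_
  have hpath := tendsto_add_sideTime_smul (P := P) (j := j) (u := u) (m := m) c
  rw [hτ_m] at hpath
  rcases hc.2.lt_or_eq with hc1 | rfl
  · have hmem : m + (c * τ) • u ∈ interior P.table := by
      rcases hc.1.eq_or_lt with rfl | hc0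
      · simpa using hm
      · exact hinside _ ⟨by positivity, mul_lt_of_lt_one_left hτ hc1⟩
    filter_upwards [hpath.eventually (isOpen_interior.mem_nhds hmem)] with p hp _ using hp
  · rw [one_mul] at hpath
    filter_upwards [hpath.eventually (eventually_mem_interior_iff hw),
      (continuous_fst.tendsto (m, (1 : ℝ))).eventually hpos] with p hp hτp hp1
    rw [hp, inward_add_sideTime_smul hneg.ne]
    exact mul_pos (sub_pos.2 hp1) ((div_pos_iff_of_pos_right (neg_pos.2 hneg)).1 hτp)

theorem Flight.eventually (h : P.Flight u m w) (hm : m ∈ interior P.table)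
    (hw : w ∈ P.openSide j) : ∀ᶠ m' in 𝓝 m, ∃ w' ∈ P.openSide j, P.Flight u m' w' := by
  have hneg := (h.inward_neg hw).ne
  have hend : ∀ᶠ m' in 𝓝 m, P.inward j (m' + (1 * P.sideTime j u m') • u - P.vertex j) = 0 →
      m' + (1 * P.sideTime j u m') • u ∈ P.openSide j := by
    have hone : Tendsto (fun m' : ℂ => (m', (1 : ℝ))) (𝓝 m) (𝓝 (m, 1)) :=
      (by fun_prop : Continuous fun m' : ℂ => (m', (1 : ℝ))).continuousAt
    refine ((tendsto_add_sideTime_smul 1).comp hone).eventually (eventually_mem_openSide ?_)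
    obtain ⟨τ, -, rfl, -⟩ := id h
    rwa [sideTime_eq hneg hw, one_mul]
  filter_upwards [h.sideTime_eventually_pos hw, h.eventually_forall_mem_interior hm hw, hend]
    with m' hτ hin hside
  refine ⟨_, hside (by simpa using inward_add_sideTime_smul hneg m' 1), P.sideTime j u m', hτ,
    by rw [one_mul], fun s hs => ?_⟩
  have hs1 : s / P.sideTime j u m' < 1 := (div_lt_one hτ).2 hs.2
  simpa only [div_mul_cancel₀ s hτ.ne'] using hin _ ⟨div_nonneg hs.1.le hτ.le, hs1.le⟩ hs1

end PolygonalBilliard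

/-! ### Reflections in the sides -/

theorem wedge_eq_im (u z : ℂ) : wedge u z = (starRingEnd ℂ u * z).im := by
  simp [wedge_apply, sub_eq_add_neg]

theorem affineIsometryEquiv_add {E : Type*} [SeminormedAddCommGroup E] [NormedSpace ℝ E]
    (g : E ≃ᵃⁱ[ℝ] E) (x y : E) : g (x + y) = g x + g.linearIsometryEquiv y := by
  rw [add_comm x, add_comm (g x)]
  exact g.map_vadd x y

theorem linearIsometryEquiv_involutive_of_fixed {f : ℂ ≃ₗᵢ[ℝ] ℂ} {u : ℂ} (hu : u ≠ 0)
    (hf : f u = u) : Function.Involutive f := by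
  obtain ⟨a, rfl | rfl⟩ := linear_isometry_complex f <;> intro z
  · have ha : (a : ℂ) = 1 := by simpa [hu] using hf
    simp [ha]
  · simp [← mul_assoc, Complex.mul_conj', Circle.norm_coe]

namespace PolygonalBilliard

variable (P : PolygonalBilliard)

/-- The reflection of the plane in the line through the `i`-th side. -/
noncomputable def refl (i : ZMod P.n) : ℂ ≃ᵃⁱ[ℝ] ℂ :=
  EuclideanGeometry.reflection line[ℝ, P.vertex i, P.vertex (i + 1)]

/-- The reflection of directions in the `i`-th side. -/
noncomputable def lin (i : ZMod P.n) : ℂ ≃ₗᵢ[ℝ] ℂ := (P.refl i).linearIsometryEquiv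

variable {P} {i j : ZMod P.n} {z w u : ℂ}

theorem refl_of_mem_openSide (hz : z ∈ P.openSide i) : P.refl i z = z := by
  have hline : z ∈ (line[ℝ, P.vertex i, P.vertex (i + 1)] : AffineSubspace ℝ ℂ) := by
    obtain ⟨t, -, rfl⟩ := mem_openSide_iff.1 hz
    rw [add_comm (P.vertex i), sideVec, ← AffineMap.lineMap_apply_module']
    exact AffineMap.lineMap_mem_affineSpan_pair t _ _
  exact (EuclideanGeometry.reflection_eq_self_iff (P := ℂ) z).2 hline

theorem refl_add (z u : ℂ) : P.refl i (z + u) = P.refl i z + P.lin i u :=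
  affineIsometryEquiv_add (P.refl i) z u

theorem lin_lin (u : ℂ) : P.lin i (P.lin i u) = u := by
  have h := refl_add (P := P) (i := i) (P.refl i 0) (P.lin i u)
  rw [← refl_add] at h
  simpa [refl] using h.symm

theorem lin_apply (u : ℂ) :
    P.lin i u = P.sideVec i / starRingEnd ℂ (P.sideVec i) * starRingEnd ℂ u := by
  have hconj : starRingEnd ℂ (P.sideVec i) ≠ 0 := (map_ne_zero _).2 (P.sideVec_ne_zero i)
  have hdirection : (line[ℝ, P.vertex i, P.vertex (i + 1)]).direction = ℝ ∙ P.sideVec i := by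
    rw [direction_affineSpan, vectorSpan_pair_rev, sideVec, vsub_eq_sub]
  change (line[ℝ, P.vertex i, P.vertex (i + 1)]).direction.reflection u = _
  simp only [hdirection, Submodule.reflection_singleton_apply, Complex.inner,
    Complex.re_eq_add_conj, Complex.real_smul, Complex.ofReal_div, RCLike.ofReal_real_eq_id, id,
    Complex.ofReal_pow]
  rw [← Complex.mul_conj']
  have hd := P.sideVec_ne_zero i
  simp only [map_mul, Complex.conj_conj, nsmul_eq_mul, Nat.cast_ofNat]
  field_simp
  ring

theorem wedge_lin_sideVec (u : ℂ) :
    wedge (P.lin i u) (P.sideVec i) = -wedge u (P.sideVec i) := by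
  have hd := P.sideVec_ne_zero i
  have hconj : starRingEnd ℂ (P.sideVec i) ≠ 0 := (map_ne_zero _).2 hd
  rw [wedge_eq_im, wedge_eq_im, lin_apply, ← Complex.conj_im]
  congr 1
  simp only [map_mul, map_div₀, Complex.conj_conj]
  field_simp

theorem wedge_lin_sub (hz : z ∈ P.openSide i) (hw : w ∈ P.openSide i) (u : ℂ) :
    wedge (P.lin i u) (z - w) = -wedge u (z - w) := by
  obtain ⟨s, -, rfl⟩ := mem_openSide_iff.1 hz
  obtain ⟨t, -, rfl⟩ := mem_openSide_iff.1 hw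
  rw [add_sub_add_left_eq_sub, ← sub_smul, map_smul, map_smul, wedge_lin_sideVec, smul_neg]

theorem inward_lin (u : ℂ) : P.inward i (P.lin i u) = -P.inward i u := by
  have h := wedge_lin_sideVec (P := P) (i := i) u
  rw [wedge_swap, wedge_swap u, neg_inj] at h
  rcases inward_eq (P := P) i with h' | h' <;> simp only [h', h, LinearMap.neg_apply, neg_neg]

variable (P) in
/-- The group generated by the reflections in the sides. Unfolding the table along a billiard orbit
moves it by elements of this group. -/
noncomputable def reflectionGroup : Subgroup (ℂ ≃ᵃⁱ[ℝ] ℂ) := Subgroup.closure (range P.refl)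

theorem refl_mem_reflectionGroup (i : ZMod P.n) : P.refl i ∈ P.reflectionGroup :=
  Subgroup.subset_closure (mem_range_self i)

variable (P) in
/-- No line in the direction `u` joins two different corners of unfolded copies of the table. -/
def Generic (u : ℂ) : Prop := u ≠ 0 ∧ ∀ g ∈ P.reflectionGroup, ∀ h ∈ P.reflectionGroup,
  ∀ k l, ∀ t : ℝ, g (P.vertex k) - h (P.vertex l) = t • u → t = 0

theorem Generic.neg (hu : P.Generic u) : P.Generic (-u) := by
  refine ⟨neg_ne_zero.2 hu.1, fun g hg h hh k l t ht => ?_⟩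
  exact neg_eq_zero.1 (hu.2 g hg h hh k l (-t) (by rw [ht, smul_neg, neg_smul]))

theorem Generic.lin (hu : P.Generic u) (i : ZMod P.n) : P.Generic (P.lin i u) := by
  refine ⟨(P.lin i).map_eq_zero_iff.not.2 hu.1, fun g hg h hh k l t ht => ?_⟩
  have hi := refl_mem_reflectionGroup i
  refine hu.2 _ (mul_mem hi hg) _ (mul_mem hi hh) k l t ?_
  simp only [AffineIsometryEquiv.coe_mul, Function.comp_apply]
  rw [← sub_add_cancel (g _) (h _), ht, add_comm, refl_add, add_sub_cancel_left, map_smul, lin_lin]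

theorem Generic.inward_ne_zero (hu : P.Generic u) (j : ZMod P.n) : P.inward j u ≠ 0 := by
  intro hj
  have hwedge : wedge u (P.sideVec j) = 0 := by
    rw [wedge_swap, inward_eq_zero_iff.1 hj, neg_zero]
  obtain ⟨t, ht⟩ := exists_smul_of_wedge_eq_zero hu.1 hwedge
  have ht0 := hu.2 1 (one_mem _) 1 (one_mem _) (j + 1) j t ht
  exact P.sideVec_ne_zero j (by rw [ht, ht0, zero_smul])

/-- An orbit that closed up after the time `t` would be moved by `g`, with the direction `u` fixed;
then `g` is a glide reflection or a translation along `u`, and its square moves the corners. -/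
theorem Generic.eq_zero_of_glide (hu : P.Generic u) {g : ℂ ≃ᵃⁱ[ℝ] ℂ} (hg : g ∈ P.reflectionGroup)
    {t : ℝ} (hgu : g.linearIsometryEquiv u = u) (hz : g (z + t • u) = z) : t = 0 := by
  have hgz : g z = z - t • u := by
    rw [affineIsometryEquiv_add, map_smul, hgu] at hz
    exact eq_sub_of_add_eq hz
  have hsq (x : ℂ) : g (g x) = x - (2 * t) • u := by
    have hlin := linearIsometryEquiv_involutive_of_fixed hu.1 hgu
    obtain ⟨v, rfl⟩ : ∃ v, x = z + v := ⟨x - z, (add_sub_cancel z x).symm⟩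
    rw [affineIsometryEquiv_add, hgz, sub_add_eq_add_sub, add_sub_assoc, affineIsometryEquiv_add,
      map_sub, hlin, map_smul, hgu, hgz]
    module
  have := hu.2 _ (mul_mem hg hg) 1 (one_mem _) 0 0 (-(2 * t)) (by simp [hsq])
  linarith

end PolygonalBilliard

/-! ### The billiard map of a finite set of directions -/

namespace PolygonalBilliard

theorem Flight.wedge_eq {P : PolygonalBilliard} {u z w : ℂ} (h : P.Flight u z w) :
    wedge u w = wedge u z := by
  obtain ⟨τ, -, rfl, -⟩ := h
  rw [map_add, map_smul, wedge_self, smul_zero, add_zero]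

/-- A finite set of directions that is invariant under the flow of the billiard and its time
reversal. -/
structure DirectionSet (P : PolygonalBilliard) where
  dirs : Set ℂ
  finite_dirs : dirs.Finite
  generic : ∀ {u}, u ∈ dirs → P.Generic u
  lin_mem : ∀ i {u}, u ∈ dirs → P.lin i u ∈ dirs
  neg_mem : ∀ {u}, u ∈ dirs → -u ∈ dirs

namespace DirectionSet

variable {P : PolygonalBilliard} (D : P.DirectionSet)

/-- A side together with a direction that points from it into the table. The balls that leave the
side in this direction form one of the intervals of the interval exchange. -/
@[ext]
structure Label where
  side : ZMod P.n
  dir : ℂ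
  dir_mem : dir ∈ D.dirs
  inward_pos : 0 < P.inward side dir

instance : Finite D.Label := by
  have : Finite D.dirs := D.finite_dirs
  refine Finite.of_injective (fun a : D.Label => (a.side, (⟨a.dir, a.dir_mem⟩ : D.dirs))) ?_
  intro a b hab
  simp only [Prod.mk.injEq, Subtype.mk.injEq] at hab
  exact Label.ext hab.1 hab.2

variable {D} {a b c : D.Label} {x y : D.Label × ℝ} {z w z' w' : ℂ} {s t : ℝ}

namespace Label

/-- The label of the balls that run backwards towards the ones with label `a`: those have just been
reflected at `a.side`. -/
noncomputable def reverse (a : D.Label) : D.Label where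
  side := a.side
  dir := -P.lin a.side a.dir
  dir_mem := D.neg_mem (D.lin_mem _ a.dir_mem)
  inward_pos := by rw [map_neg, inward_lin, neg_neg]; exact a.inward_pos

theorem reverse_reverse (a : D.Label) : a.reverse.reverse = a := by
  ext
  · rfl
  · simp only [reverse, map_neg, lin_lin, neg_neg]

theorem wedge_dir_sideVec_ne_zero (a : D.Label) : wedge a.dir (P.sideVec a.side) ≠ 0 := by
  rw [wedge_swap, neg_ne_zero]
  exact inward_eq_zero_iff.not.1 a.inward_pos.ne'

/-- The point of the line through the side `a.side` with transversal coordinate `s`, where the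
transversal coordinate of `z` is `wedge a.dir z`. -/
noncomputable def point (a : D.Label) (s : ℝ) : ℂ :=
  P.vertex a.side +
    ((s - wedge a.dir (P.vertex a.side)) / wedge a.dir (P.sideVec a.side)) • P.sideVec a.side

theorem wedge_point (a : D.Label) (s : ℝ) : wedge a.dir (a.point s) = s := by
  rw [point, map_add, map_smul, smul_eq_mul, div_mul_cancel₀ _ a.wedge_dir_sideVec_ne_zero,
    add_sub_cancel]

theorem point_wedge (hz : z ∈ P.openSide a.side) : a.point (wedge a.dir z) = z := by
  obtain ⟨t, -, rfl⟩ := mem_openSide_iff.1 hz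
  rw [point, map_add, add_sub_cancel_left, map_smul, smul_eq_mul,
    mul_div_cancel_right₀ _ a.wedge_dir_sideVec_ne_zero]

theorem continuous_point (a : D.Label) : Continuous a.point := by
  unfold point
  fun_prop

/-- The transversal coordinates of the points of the side. -/
def interval (a : D.Label) : Set ℝ := a.point ⁻¹' P.openSide a.side

theorem interval_eq_image (a : D.Label) : a.interval = wedge a.dir '' P.openSide a.side := by
  ext s
  constructor
  · exact fun hs => ⟨_, hs, a.wedge_point s⟩
  · rintro ⟨z, hz, rfl⟩
    rwa [interval, mem_preimage, point_wedge hz]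

theorem convex_interval (a : D.Label) : Convex ℝ a.interval := by
  rw [interval_eq_image]
  exact (convex_openSegment _ _).linear_image (wedge a.dir)

theorem isOpen_interval (a : D.Label) : IsOpen a.interval := by
  refine isOpen_iff_eventually.2 fun s hs => ?_
  filter_upwards [a.continuous_point.continuousAt.eventually (eventually_mem_openSide hs)] with t ht
  exact ht (by rw [point, add_sub_cancel_left, map_smul, inward_sideVec, smul_zero])

theorem isBounded_interval (a : D.Label) : Bornology.IsBounded a.interval := by
  rw [interval_eq_image]
  have hcompact := P.isCompact_table.image (continuous_wedge a.dir)
  exact hcompact.isBounded.subset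
    (image_mono (openSide_subset_frontier.trans frontier_subset_table))

end Label

/-- A ball that leaves the point `z` of the side `a.side` with the direction `a.dir` next hits the
boundary at the point `w` of the side `b.side`, where it is reflected into the direction `b.dir`. -/
structure Chord (a : D.Label) (z : ℂ) (b : D.Label) (w : ℂ) : Prop where
  left_mem : z ∈ P.openSide a.side
  right_mem : w ∈ P.openSide b.side
  dir_eq : b.dir = P.lin b.side a.dir
  flight : P.Flight a.dir z w

theorem Chord.reverse (h : Chord a z b w) : Chord b.reverse w a.reverse z where
  left_mem := h.right_mem
  right_mem := h.left_mem
  dir_eq := by simp only [Label.reverse, h.dir_eq, lin_lin, map_neg]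
  flight := by simpa only [Label.reverse, h.dir_eq, lin_lin] using h.flight.symm

theorem Chord.right_unique (h : Chord a z b w) (h' : Chord a z c w') : b = c ∧ w = w' := by
  have hw : w = w' := h.flight.right_unique h'.flight (openSide_subset_frontier h.right_mem)
    (openSide_subset_frontier h'.right_mem)
  subst hw
  have hside : b.side = c.side := P.openSide_unique h.right_mem h'.right_mem
  exact ⟨Label.ext hside (by rw [h.dir_eq, h'.dir_eq, hside]), rfl⟩

theorem Chord.left_unique (h : Chord a z c w) (h' : Chord b z' c w) : a = b ∧ z = z' := by
  obtain ⟨hab, hz⟩ := h.reverse.right_unique h'.reverse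
  exact ⟨by rw [← a.reverse_reverse, hab, b.reverse_reverse], hz⟩

theorem exists_chord_or_vertex (hz : z ∈ P.openSide a.side) :
    (∃ b w, Chord a z b w) ∨ ∃ k, P.Flight a.dir z (P.vertex k) := by
  obtain ⟨w, hw, hflight⟩ := exists_flight_of_mem_openSide hz a.inward_pos
  rcases mem_frontier_iff.1 hw with ⟨k, rfl⟩ | ⟨j, hj⟩
  · exact .inr ⟨k, hflight⟩
  · have hin : 0 < P.inward j (P.lin j a.dir) := by
      rw [inward_lin]
      exact neg_pos.2 (hflight.inward_neg hj)
    exact .inl ⟨⟨j, P.lin j a.dir, D.lin_mem j a.dir_mem, hin⟩, w, hz, hj, rfl, hflight⟩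

theorem exists_chord_or_vertex_reverse (hz : z ∈ P.openSide a.side) :
    (∃ b w, Chord b w a z) ∨ ∃ k, P.Flight a.reverse.dir z (P.vertex k) := by
  refine (exists_chord_or_vertex (a := a.reverse) hz).imp_left ?_
  rintro ⟨b, w, h⟩
  exact ⟨b.reverse, w, by simpa only [Label.reverse_reverse] using h.reverse⟩

/-- The billiard map in the coordinates given by the labels. -/
def Bounce (x y : D.Label × ℝ) : Prop := Chord x.1 (x.1.point x.2) y.1 (y.1.point y.2)

theorem Chord.bounce (h : Chord a z b w) : Bounce (a, wedge a.dir z) (b, wedge b.dir w) := by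
  unfold Bounce
  rwa [Label.point_wedge h.left_mem, Label.point_wedge h.right_mem]

theorem Label.prod_ext (h : x.1 = y.1) (hpoint : x.1.point x.2 = y.1.point y.2) : x = y := by
  obtain ⟨a, s⟩ := x
  obtain ⟨b, t⟩ := y
  obtain rfl : a = b := h
  rw [← a.wedge_point s, ← a.wedge_point t]
  exact congrArg (fun z => (a, wedge a.dir z)) hpoint

theorem Chord.eventually (h : Chord a z b w) :
    ∀ᶠ s in 𝓝 (wedge a.dir z), ∃ z' w', Chord a z' b w' ∧ wedge a.dir z' = s := by
  obtain ⟨m, hm, hzm, hmw⟩ := h.flight.exists_mid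
  set v : ℂ := (wedge a.dir (P.sideVec a.side))⁻¹ • P.sideVec a.side
  have hv : wedge a.dir v = 1 := by
    rw [map_smul, smul_eq_mul, inv_mul_cancel₀ a.wedge_dir_sideVec_ne_zero]
  have hmove : Tendsto (fun s : ℝ => m + (s - wedge a.dir z) • v) (𝓝 (wedge a.dir z)) (𝓝 m) := by
    have : Continuous fun s : ℝ => m + (s - wedge a.dir z) • v := by fun_prop
    simpa using this.tendsto (wedge a.dir z)
  filter_upwards [hmove.eventually (hmw.eventually hm h.right_mem),
    hmove.eventually (hzm.symm.eventually hm h.left_mem),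
    hmove.eventually (isOpen_interior.mem_nhds hm)] with s ⟨w', hw', hmw'⟩ ⟨z', hz', hmz'⟩ hm'
  have hzm' : P.Flight a.dir z' (m + (s - wedge a.dir z) • v) := by simpa using hmz'.symm
  refine ⟨z', w', ⟨hz', hw', h.dir_eq, hzm'.trans hm' hmw'⟩, ?_⟩
  rw [← hzm'.wedge_eq, map_add, map_smul, hv, hzm.wedge_eq, smul_eq_mul, mul_one, add_sub_cancel]

/-- The reflection at `b.side` reverses the orientation. -/
theorem Chord.wedge_sub_wedge (h : Chord a z b w) (h' : Chord a z' b w') :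
    wedge b.dir w' - wedge b.dir w = -(wedge a.dir z' - wedge a.dir z) := by
  rw [← map_sub, h.dir_eq, wedge_lin_sub h'.right_mem h.right_mem, map_sub, h.flight.wedge_eq,
    h'.flight.wedge_eq]

theorem Bounce.eventually (h : Bounce x y) :
    ∀ᶠ ε in 𝓝 (0 : ℝ), Bounce (x.1, x.2 + ε) (y.1, y.2 - ε) := by
  have hshift : Tendsto (fun ε : ℝ => x.2 + ε) (𝓝 0) (𝓝 (wedge x.1.dir (x.1.point x.2))) := by
    have : Continuous fun ε : ℝ => x.2 + ε := by fun_prop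
    simpa [Label.wedge_point] using this.tendsto 0
  filter_upwards [hshift.eventually (Chord.eventually h)] with ε ⟨z', w', h', hz'⟩
  have hw' := Chord.wedge_sub_wedge h h'
  rw [Label.wedge_point, Label.wedge_point, hz', add_sub_cancel_left, sub_eq_iff_eq_add,
    neg_add_eq_sub] at hw'
  simpa only [hz', hw'] using h'.bounce

/-- Along an orbit segment of length `t` the table is unfolded by a composition of reflections,
whose inverse maps the orbit segment onto a straight line segment. -/
def Unfolded (x y : D.Label × ℝ) (t : ℝ) : Prop :=
  ∃ g ∈ P.reflectionGroup, y.1.dir = g.linearIsometryEquiv x.1.dir ∧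
    y.1.point y.2 = g (x.1.point x.2 + t • x.1.dir)

theorem Unfolded.bounce {x' : D.Label × ℝ} (h : Unfolded x y t) (hy : Bounce y x') :
    ∃ t' > t, Unfolded x x' t' := by
  obtain ⟨g, hg, hdir, hpoint⟩ := h
  obtain ⟨τ, hτ, hflight, -⟩ := Chord.flight hy
  have hrefl := refl_of_mem_openSide (Chord.right_mem hy)
  refine ⟨t + τ, lt_add_of_pos_right t hτ, _, mul_mem (refl_mem_reflectionGroup x'.1.side) hg,
    by rw [Chord.dir_eq hy, hdir]; rfl, ?_⟩
  rw [AffineIsometryEquiv.coe_mul, Function.comp_apply, add_smul, ← add_assoc,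
    affineIsometryEquiv_add, ← hpoint, map_smul, ← hdir, ← hflight, hrefl]

theorem exists_unfolded_of_reflTransGen (h : Relation.ReflTransGen Bounce x y) :
    ∃ t ≥ 0, Unfolded x y t := by
  induction h with
  | refl => exact ⟨0, le_rfl, 1, one_mem _, rfl, by simp⟩
  | tail _ hy ih =>
    obtain ⟨t, ht, hunfolded⟩ := ih
    obtain ⟨t', htt', hunfolded'⟩ := hunfolded.bounce hy
    exact ⟨t', ht.trans htt'.le, hunfolded'⟩

theorem not_transGen_bounce (x : D.Label × ℝ) : ¬ Relation.TransGen Bounce x x := by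
  intro h
  obtain ⟨y, hxy, hyx⟩ := Relation.TransGen.tail'_iff.1 h
  obtain ⟨t, ht, hunfolded⟩ := exists_unfolded_of_reflTransGen hxy
  obtain ⟨t', htt', g, hg, hdir, hpoint⟩ := hunfolded.bounce hyx
  exact (ht.trans_lt htt').ne' ((D.generic x.1.dir_mem).eq_zero_of_glide hg hdir.symm hpoint.symm)

theorem exists_bounce_or_vertex (hx : x.2 ∈ x.1.interval) :
    (∃ y, Bounce x y) ∨ ∃ k, P.Flight x.1.dir (x.1.point x.2) (P.vertex k) := by
  refine (exists_chord_or_vertex hx).imp_left ?_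
  rintro ⟨b, w, h⟩
  exact ⟨_, by simpa only [Label.wedge_point] using h.bounce⟩

theorem exists_bounce_or_vertex_reverse (hx : x.2 ∈ x.1.interval) :
    (∃ y, Bounce y x) ∨ ∃ k, ∃ σ > (0 : ℝ),
      P.refl x.1.side (P.vertex k) = x.1.point x.2 - σ • x.1.dir := by
  refine (exists_chord_or_vertex_reverse hx).imp ?_ ?_
  · rintro ⟨b, w, h⟩
    exact ⟨_, by simpa only [Label.wedge_point] using h.bounce⟩
  · rintro ⟨k, σ, hσ, hk, -⟩
    refine ⟨k, σ, hσ, ?_⟩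
    rw [hk, refl_add, refl_of_mem_openSide hx, Label.reverse, map_smul, map_neg, lin_lin, smul_neg,
      sub_eq_add_neg]

theorem Bounce.mem_left (h : Bounce x y) : x.2 ∈ x.1.interval := Chord.left_mem h

theorem Bounce.mem_right (h : Bounce x y) : y.2 ∈ y.1.interval := Chord.right_mem h

theorem exists_bounce_of_reflTransGen (hx : x.2 ∈ x.1.interval) (hx' : ∀ w, ¬ Bounce w x)
    (hxy : Relation.ReflTransGen Bounce x y) : ∃ z, Bounce y z := by
  by_contra! hy'
  have hy : y.2 ∈ y.1.interval := by
    rcases hxy.cases_tail with rfl | ⟨z, -, hzy⟩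
    exacts [hx, hzy.mem_right]
  obtain ⟨t, ht, g, hg, hdir, hpoint⟩ := exists_unfolded_of_reflTransGen hxy
  obtain ⟨k, σ, hσ, hk⟩ := (exists_bounce_or_vertex_reverse hx).resolve_left
    fun ⟨w, hw⟩ => hx' w hw
  obtain ⟨l, τ, hτ, hl, -⟩ := (exists_bounce_or_vertex hy).resolve_left fun ⟨w, hw⟩ => hy' w hw
  have hl' : g⁻¹ (P.vertex l) = x.1.point x.2 + (t + τ) • x.1.dir := by
    rw [hl, hpoint, hdir, ← map_smul, ← affineIsometryEquiv_add, add_assoc, ← add_smul]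
    exact g.symm_apply_apply _
  have := (D.generic x.1.dir_mem).2 _ (inv_mem hg) _ (refl_mem_reflectionGroup x.1.side) l k
    (t + τ + σ) (by rw [hk, hl']; module)
  linarith

theorem finite_forall_not_bounce :
    {x : D.Label × ℝ | x.2 ∈ x.1.interval ∧ ∀ y, ¬ Bounce x y}.Finite := by
  refine (finite_range fun p : D.Label × ZMod P.n => (p.1, wedge p.1.dir (P.vertex p.2))).subset ?_
  rintro x ⟨hx, hx'⟩
  obtain ⟨k, hk⟩ := (exists_bounce_or_vertex hx).resolve_left fun ⟨y, hy⟩ => hx' y hy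
  exact ⟨(x.1, k), Prod.ext rfl (hk.wedge_eq.trans (x.1.wedge_point x.2))⟩

theorem finite_forall_not_bounce_reverse :
    {x : D.Label × ℝ | x.2 ∈ x.1.interval ∧ ∀ y, ¬ Bounce y x}.Finite := by
  refine (finite_range fun p : D.Label × ZMod P.n =>
    (p.1, wedge p.1.dir (P.refl p.1.side (P.vertex p.2)))).subset ?_
  rintro x ⟨hx, hx'⟩
  obtain ⟨k, σ, -, hk⟩ := (exists_bounce_or_vertex_reverse hx).resolve_left
    fun ⟨w, hw⟩ => hx' w hw
  refine ⟨(x.1, k), Prod.ext rfl ?_⟩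
  simp only [hk, map_sub, map_smul, wedge_self, smul_zero, sub_zero, Label.wedge_point]

variable (D) in
/-- The billiard map in the directions of `D`. Each reflection reverses the transversal
orientation. -/
noncomputable def bounceMap : FlippedIntervalExchange D.Label where
  dom := Label.interval
  Step := Bounce
  convex_dom := Label.convex_interval
  isOpen_dom := Label.isOpen_interval
  isBounded_dom := Label.isBounded_interval
  mem_left := Bounce.mem_left
  mem_right := Bounce.mem_right
  right_unique h h' := by
    obtain ⟨hlabel, hpoint⟩ := Chord.right_unique h h'
    exact Label.prod_ext hlabel hpoint
  left_unique h h' := by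
    obtain ⟨hlabel, hpoint⟩ := Chord.left_unique h h'
    exact Label.prod_ext hlabel hpoint
  isometry := Bounce.eventually
  finite_no_image := finite_forall_not_bounce
  finite_no_preimage := finite_forall_not_bounce_reverse
  no_connection := exists_bounce_of_reflTransGen
  no_periodic := not_transGen_bounce

end DirectionSet

end PolygonalBilliard

/-! ### Minimality of the billiard map -/

namespace PolygonalBilliard

namespace DirectionSet

variable {P : PolygonalBilliard} {D : P.DirectionSet} {a b : D.Label} {u z m : ℂ} {i : ZMod P.n}

/-- The line through `m` in the direction `u` starts at the side `a.side` with label `a`, or it ends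
there and the ball leaves the side with label `a` after the reflection. -/
def OnLine (a : D.Label) (u m : ℂ) : Prop :=
  (a.dir = u ∧ ∃ z ∈ P.openSide a.side, P.Flight u z m) ∨
    (a.dir = P.lin a.side u ∧ ∃ w ∈ P.openSide a.side, P.Flight u m w)

theorem OnLine.mem_iff {L : Set D.Label} (hL : ∀ {a z b w}, Chord a z b w → (a ∈ L ↔ b ∈ L))
    (hm : m ∈ interior P.table) (ha : OnLine a u m) (hb : OnLine b u m) : a ∈ L ↔ b ∈ L := by
  rcases ha with ⟨hau, z, hz, hzm⟩ | ⟨hau, w, hw, hmw⟩ <;>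
    rcases hb with ⟨hbu, z', hz', hzm'⟩ | ⟨hbu, w', hw', hmw'⟩
  · have hzz' := hzm.symm.right_unique hzm'.symm (openSide_subset_frontier hz)
      (openSide_subset_frontier hz')
    have hside : a.side = b.side := P.openSide_unique hz (hzz' ▸ hz')
    rw [Label.ext hside (hau.trans hbu.symm)]
  · subst hau
    exact hL ⟨hz, hw', hbu, hzm.trans hm hmw'⟩
  · subst hbu
    exact (hL ⟨hz', hw, hau, hzm'.trans hm hmw⟩).symm
  · have hww' := hmw.right_unique hmw' (openSide_subset_frontier hw) (openSide_subset_frontier hw')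
    have hside : a.side = b.side := P.openSide_unique hw (hww' ▸ hw')
    rw [Label.ext hside (by rw [hau, hbu, hside])]

theorem isOpen_setOf_onLine (L : Set D.Label) (u : ℂ) :
    IsOpen {m | m ∈ interior P.table ∧ ∃ a ∈ L, OnLine a u m} := by
  rw [isOpen_iff_eventually]
  rintro m ⟨hm, a, ha, ⟨hau, z, hz, hzm⟩ | ⟨hau, w, hw, hmw⟩⟩
  · filter_upwards [isOpen_interior.mem_nhds hm, hzm.symm.eventually hm hz]
      with m' hm' ⟨z', hz', hmz'⟩
    exact ⟨hm', a, ha, .inl ⟨hau, z', hz', by simpa using hmz'.symm⟩⟩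
  · filter_upwards [isOpen_interior.mem_nhds hm, hmw.eventually hm hw] with m' hm' ⟨w', hw', hmw'⟩
    exact ⟨hm', a, ha, .inr ⟨hau, w', hw', hmw'⟩⟩

theorem exists_onLine_of_mem_interior (hu : u ∈ D.dirs) (hm : m ∈ interior P.table) :
    ∃ a : D.Label, OnLine a u m := by
  have hgeneric := D.generic hu
  obtain ⟨w, hw, hmw⟩ := exists_flight_of_mem_interior hgeneric.1 hm
  obtain ⟨z, hz, hmz⟩ := exists_flight_of_mem_interior hgeneric.neg.1 hm
  have hzm : P.Flight u z m := by simpa using hmz.symm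
  rcases mem_frontier_iff.1 hw with ⟨k, rfl⟩ | ⟨j, hj⟩
  · rcases mem_frontier_iff.1 hz with ⟨l, rfl⟩ | ⟨i, hi⟩
    · obtain ⟨τ, hτ, hk, -⟩ := hzm.trans hm hmw
      have := hgeneric.2 1 (one_mem _) 1 (one_mem _) k l τ (by simp [hk])
      exact absurd this hτ.ne'
    · exact ⟨⟨i, u, hu, hzm.inward_pos hi⟩, .inl ⟨rfl, z, hi, hzm⟩⟩
  · have hin : 0 < P.inward j (P.lin j u) := by
      rw [inward_lin]
      exact neg_pos.2 (hmw.inward_neg hj)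
    exact ⟨⟨j, _, D.lin_mem j hu, hin⟩, .inr ⟨rfl, w, hj, hmw⟩⟩

theorem Label.exists_onLine (a : D.Label) : ∃ m ∈ interior P.table, OnLine a a.dir m := by
  obtain ⟨z, hz⟩ := P.nonempty_openSide a.side
  obtain ⟨w, -, hflight⟩ := exists_flight_of_mem_openSide hz a.inward_pos
  obtain ⟨m, hm, hzm, -⟩ := hflight.exists_mid
  exact ⟨m, hm, .inl ⟨rfl, z, hz, hzm⟩⟩

theorem exists_onLine_of_side (hu : u ∈ D.dirs) (i : ZMod P.n) :
    ∃ a : D.Label, a.side = i ∧ ∃ m ∈ interior P.table, OnLine a u m := by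
  obtain ⟨z, hz⟩ := P.nonempty_openSide i
  rcases ((D.generic hu).inward_ne_zero i).lt_or_gt with hneg | hpos
  · have hin : 0 < P.inward i (-u) := by rwa [map_neg, neg_pos]
    obtain ⟨w, -, hflight⟩ := exists_flight_of_mem_openSide hz hin
    obtain ⟨m, hm, hzm, -⟩ := hflight.exists_mid
    exact ⟨⟨i, _, D.lin_mem i hu, by rwa [inward_lin, neg_pos]⟩, rfl, m, hm,
      .inr ⟨rfl, z, hz, by simpa using hzm.symm⟩⟩
  · exact ⟨⟨i, u, hu, hpos⟩, rfl, Label.exists_onLine _⟩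

/-- The interior of the table is connected, hence cannot be divided into the lines that start in
`L` and those that do not. -/
theorem exists_label_mem_of_side {L : Set D.Label}
    (hL : ∀ {a z b w}, Chord a z b w → (a ∈ L ↔ b ∈ L)) (hne : L.Nonempty) (i : ZMod P.n) :
    ∃ a ∈ L, a.side = i := by
  obtain ⟨a₀, ha₀⟩ := hne
  have hu := a₀.dir_mem
  set u := a₀.dir
  set U : Set D.Label → Set ℂ := fun L => {m | m ∈ interior P.table ∧ ∃ a ∈ L, OnLine a u m}
  have hdisjoint : Disjoint (U L) (U Lᶜ) := by
    rw [Set.disjoint_left]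
    rintro m ⟨hm, a, ha, ham⟩ ⟨-, b, hb, hbm⟩
    exact hb ((ham.mem_iff hL hm hbm).1 ha)
  have hcover : interior P.table ⊆ U L ∪ U Lᶜ := by
    intro m hm
    obtain ⟨a, ham⟩ := exists_onLine_of_mem_interior hu hm
    by_cases ha : a ∈ L
    exacts [.inl ⟨hm, a, ha, ham⟩, .inr ⟨hm, a, ha, ham⟩]
  obtain ⟨m₀, hm₀, ham₀⟩ := a₀.exists_onLine
  have hsubset : interior P.table ⊆ U L :=
    P.isConnected_interior_table.isPreconnected.subset_left_of_subset_union
      (isOpen_setOf_onLine L u) (isOpen_setOf_onLine Lᶜ u) hdisjoint hcover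
      ⟨m₀, hm₀, hm₀, a₀, ha₀, ham₀⟩
  obtain ⟨a, hai, m, hm, ham⟩ := exists_onLine_of_side hu i
  obtain ⟨-, b, hb, hbm⟩ := hsubset hm
  exact ⟨a, (hbm.mem_iff hL hm ham).1 hb, hai⟩

theorem openSide_subset_closure_orbit {x : D.Label × ℝ}
    (hforward : ∀ y, Relation.ReflTransGen Bounce x y → ∃ z, Bounce y z) (i : ZMod P.n) :
    P.openSide i ⊆ closure ((fun y : D.Label × ℝ => y.1.point y.2) ''
      {y | Relation.ReflTransGen Bounce x y ∧ y.1.side = i}) := by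
  let L : Set D.Label := {a | ∃ s, Relation.ReflTransGen Bounce x (a, s)}
  have hdense {a} (ha : a ∈ L) : a.interval ⊆ closure {t | Relation.TransGen Bounce x (a, t)} :=
    D.bounceMap.dom_subset_closure_orbit hforward ha.choose_spec
  have hL {a z b w} (h : Chord a z b w) : a ∈ L ↔ b ∈ L := by
    constructor
    · exact fun ha => closure_nonempty_iff.1 ⟨_, D.bounceMap.mem_closure_fiber_of_step
        (O' := {y | Relation.ReflTransGen Bounce x y})
        (fun y z hyz hxy => hxy.to_reflTransGen.tail hyz)
        h.bounce (hdense ha h.bounce.mem_left)⟩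
    · refine fun hb => closure_nonempty_iff.1 ⟨_, D.bounceMap.inverse.mem_closure_fiber_of_step
        (O := {y | Relation.TransGen Bounce x y}) (fun z y hyz hxz => ?_) h.bounce
        (hdense hb h.bounce.mem_right)⟩
      obtain ⟨y', hxy', hy'z⟩ := Relation.TransGen.tail'_iff.1 hxz
      rwa [D.bounceMap.left_unique hyz hy'z]
  obtain ⟨a, ha, rfl⟩ := exists_label_mem_of_side hL ⟨x.1, x.2, .refl⟩ i
  intro z hz
  have hmem : wedge a.dir z ∈ closure {t | Relation.TransGen Bounce x (a, t)} :=
    hdense ha (by rwa [Label.interval, mem_preimage, Label.point_wedge hz])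
  rw [← Label.point_wedge hz]
  exact map_mem_closure a.continuous_point hmem fun t ht =>
    ⟨(a, t), ⟨ht.to_reflTransGen, rfl⟩, rfl⟩

end DirectionSet

end PolygonalBilliard

/-! ### Almost every direction is generic -/

theorem countable_setOf_smul_toCircle_eq {d : ℂ} (hd : d ≠ 0) :
    {θ : ℝ | ∃ t : ℝ, d = t • ((θ : Real.Angle).toCircle : ℂ)}.Countable := by
  refine (countable_range fun k : ℤ => d.arg - k * Real.pi).mono ?_
  rintro θ ⟨t, ht⟩
  have hwedge : wedge (θ : Real.Angle).toCircle d = ‖d‖ * Real.sin (d.arg - θ) := by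
    rw [Real.sin_sub, mul_sub, ← mul_assoc, ← mul_assoc, Complex.norm_mul_sin_arg,
      Complex.norm_mul_cos_arg, wedge_apply, Real.Angle.toCircle_coe, Circle.coe_exp,
      Complex.exp_ofReal_mul_I_re, Complex.exp_ofReal_mul_I_im]
    ring
  have hzero : wedge (θ : Real.Angle).toCircle d = 0 := by
    rw [ht, map_smul, wedge_self, smul_zero]
  rw [hwedge, mul_eq_zero, or_iff_right (norm_ne_zero_iff.2 hd), Real.sin_eq_zero_iff] at hzero
  obtain ⟨k, hk⟩ := hzero
  exact ⟨k, (sub_eq_iff_eq_add.2 (sub_eq_iff_eq_add'.1 hk.symm))⟩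

theorem isOfFinAddOrder_coe_rat_mul_pi (q : ℚ) :
    IsOfFinAddOrder ((q * Real.pi : ℝ) : Real.Angle) := by
  have : Fact (0 < 2 * Real.pi) := ⟨Real.two_pi_pos⟩
  refine AddCircle.isOfFinAddOrder_iff_exists_rat_eq_div.2 ⟨q / 2, ?_⟩
  have := Real.pi_ne_zero
  push_cast
  field_simp

theorem toCircle_reflectDir_arg {d : ℂ} (hd : d ≠ 0) (θ : Real.Angle) :
    ((reflectDir (d.arg : Real.Angle) θ).toCircle : ℂ) =
      d / starRingEnd ℂ d * starRingEnd ℂ θ.toCircle := by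
  have hnorm : (‖d‖ : ℂ) ≠ 0 := by simpa using hd
  have hd' : d / starRingEnd ℂ d = Complex.exp (d.arg * Complex.I) ^ 2 := by
    conv_lhs => rw [← Complex.norm_mul_exp_arg_mul_I d]
    rw [map_mul, Complex.conj_ofReal, mul_div_mul_left _ _ hnorm, ← Complex.exp_conj, map_mul,
      Complex.conj_I, Complex.conj_ofReal, ← Complex.exp_sub, ← Complex.exp_nat_mul]
    congr 1
    push_cast
    ring
  rw [hd', sq, reflectDir, sub_eq_add_neg, two_nsmul, Real.Angle.toCircle_add,
    Real.Angle.toCircle_add, Real.Angle.toCircle_neg, Circle.coe_mul, Circle.coe_mul,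
    Circle.coe_inv_eq_conj, Real.Angle.toCircle_coe, Circle.coe_exp]

namespace PolygonalBilliard

variable {P : PolygonalBilliard} {i₀ : ZMod P.n}

instance countable_reflectionGroup : Countable P.reflectionGroup := by
  rw [reflectionGroup, ← FreeGroup.range_lift_eq_closure]
  exact (countable_range (FreeGroup.lift P.refl)).to_subtype

variable (P) in
theorem ae_generic : ∀ᵐ θ : ℝ, P.Generic (θ : Real.Angle).toCircle := by
  have hpair (g h : P.reflectionGroup) (k l : ZMod P.n) : ∀ᵐ θ : ℝ, ∀ t : ℝ,
      g.1 (P.vertex k) - h.1 (P.vertex l) = t • ((θ : Real.Angle).toCircle : ℂ) → t = 0 := by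
    by_cases hd : g.1 (P.vertex k) - h.1 (P.vertex l) = 0
    · refine .of_forall fun θ t ht => ?_
      rw [hd, eq_comm, smul_eq_zero] at ht
      exact ht.resolve_right (Circle.coe_ne_zero _)
    · filter_upwards [(countable_setOf_smul_toCircle_eq hd).ae_notMem volume] with θ hθ t ht
      exact absurd ⟨t, ht⟩ hθ
  filter_upwards [ae_all_iff.2 fun g => ae_all_iff.2 fun h => ae_all_iff.2 fun k =>
    ae_all_iff.2 (hpair g h k)] with θ hθ
  exact ⟨Circle.coe_ne_zero _, fun g hg h hh => hθ ⟨g, hg⟩ ⟨h, hh⟩⟩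

theorem IsRational.exists_angle_eq (hP : P.IsRational) (i : ZMod P.n) : ∃ q : ℚ,
    EuclideanGeometry.angle (P.vertex (i - 1)) (P.vertex i) (P.vertex (i + 1)) = q * Real.pi := by
  obtain ⟨q, hq⟩ := hP i
  unfold interiorAngle at hq
  split_ifs at hq
  · exact ⟨q, hq⟩
  · exact ⟨2 - q, by push_cast; linarith⟩

theorem IsRational.isOfFinAddOrder_arg_sideVec_sub (hP : P.IsRational) (i : ZMod P.n) :
    IsOfFinAddOrder ((P.sideVec (i - 1)).arg - (P.sideVec i).arg : Real.Angle) := by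
  obtain ⟨q, hq⟩ := hP.exists_angle_eq i
  have hprev : P.vertex (i - 1) -ᵥ P.vertex i = -P.sideVec (i - 1) := by
    rw [sideVec, sub_add_cancel, neg_sub, vsub_eq_sub]
  have hne := P.sideVec_ne_zero i
  have hne' := P.sideVec_ne_zero (i - 1)
  rw [EuclideanGeometry.angle, hprev, vsub_eq_sub (P.vertex (i + 1)), ← sideVec,
    Complex.angle_eq_abs_arg (neg_ne_zero.2 hne') hne] at hq
  have hfin : IsOfFinAddOrder ((-P.sideVec (i - 1) / P.sideVec i).arg : Real.Angle) := by
    rcases (abs_eq (hq ▸ abs_nonneg _)).1 hq with h | h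
    · rw [h]
      exact isOfFinAddOrder_coe_rat_mul_pi q
    · rw [h, Real.Angle.coe_neg]
      exact (isOfFinAddOrder_coe_rat_mul_pi q).neg
  rw [Complex.arg_div_coe_angle (neg_ne_zero.2 hne') hne, Complex.arg_neg_coe_angle hne',
    add_sub_right_comm] at hfin
  have hpi := isOfFinAddOrder_coe_rat_mul_pi 1
  rw [Rat.cast_one, one_mul] at hpi
  simpa only [add_neg_cancel_right] using hfin.add hpi.neg

theorem IsRational.isOfFinAddOrder_arg_sideVec (hP : P.IsRational)
    (h₀ : IsOfFinAddOrder ((P.sideVec i₀).arg : Real.Angle)) (i : ZMod P.n) :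
    IsOfFinAddOrder ((P.sideVec i).arg : Real.Angle) := by
  have hadd (k : ℕ) : IsOfFinAddOrder ((P.sideVec (i₀ + k)).arg : Real.Angle) := by
    induction k with
    | zero => simpa using h₀
    | succ k ih =>
      have hk := hP.isOfFinAddOrder_arg_sideVec_sub (i₀ + (k + 1 : ℕ))
      rw [Nat.cast_succ, ← add_assoc, add_sub_cancel_right] at hk
      simpa [← add_assoc] using ih.add hk.neg
  simpa using hadd (i - i₀).val

end PolygonalBilliard

/-! ### Directions of a rational Andreev billiard -/

namespace PolygonalAndreevBilliard

variable {P : PolygonalAndreevBilliard} {i : ZMod P.n} {θ φ : Real.Angle}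

theorem exists_andreevSegment_subset_openSide : ∃ i, P.andreevSegment ⊆ P.openSide i := by
  have hside {z : ℂ} (hz : z ∈ P.andreevSegment) : ∃ i, z ∈ P.openSide i :=
    (PolygonalBilliard.mem_frontier_iff.1 (P.andreevSegment_subset hz).1).resolve_left
      (P.andreevSegment_subset hz).2
  obtain ⟨z, hz⟩ := P.andreevSegment_nontrivial.nonempty
  obtain ⟨i, hi⟩ := hside hz
  refine ⟨i, fun w hw => ?_⟩
  obtain ⟨j, hj, hwj⟩ : ∃ j, z ∈ P.openSide j ∧ w ∈ P.openSide j := by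
    refine P.andreevSegment_connected.isPreconnected.induction₂
      (fun z w => ∃ i, z ∈ P.openSide i ∧ w ∈ P.openSide i) (fun x hx => ?_) ?_ ?_ hz hw
    · obtain ⟨j, hj⟩ := hside hx
      filter_upwards [eventually_nhdsWithin_of_eventually_nhds
        (PolygonalBilliard.eventually_mem_openSide_of_mem_frontier hj), self_mem_nhdsWithin]
        with y hy hyA
      exact ⟨j, hj, hy (P.andreevSegment_subset hyA).1⟩
    · rintro x y v - - - ⟨j, hxj, hyj⟩ ⟨k, hyk, hvk⟩
      exact ⟨j, hxj, P.openSide_unique hyk hyj ▸ hvk⟩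
    · rintro x y - - ⟨j, hxj, hyj⟩
      exact ⟨j, hyj, hxj⟩
  exact P.openSide_unique hj hi ▸ hwj

variable (P) in
/-- The side that contains the Andreev segment. -/
noncomputable def andreevSide : ZMod P.n := exists_andreevSegment_subset_openSide.choose

theorem andreevSegment_subset_openSide : P.andreevSegment ⊆ P.openSide P.andreevSide :=
  exists_andreevSegment_subset_openSide.choose_spec

variable (P) in
theorem sideVec_andreevSide_re : (P.sideVec P.andreevSide).re = 0 := by
  obtain ⟨z, hz, w, hw, hzw⟩ := P.andreevSegment_nontrivial
  obtain ⟨s, -, rfl⟩ := PolygonalBilliard.mem_openSide_iff.1 (andreevSegment_subset_openSide hz)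
  obtain ⟨t, -, rfl⟩ := PolygonalBilliard.mem_openSide_iff.1 (andreevSegment_subset_openSide hw)
  have hre := P.andreevSegment_vertical _ hz _ hw
  rw [Complex.add_re, Complex.add_re, add_right_inj, Complex.smul_re, Complex.smul_re,
    smul_eq_mul, smul_eq_mul, mul_eq_mul_right_iff] at hre
  exact hre.resolve_left fun hst => hzw (by rw [hst])

theorem reflectDir_andreevSide (θ : Real.Angle) :
    reflectDir (P.sideAngle .plus P.andreevSide) θ = (Real.pi : Real.Angle) - θ := by
  have hangle : (2 : ℕ) • P.sideAngle .plus P.andreevSide = Real.pi := by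
    rw [Real.Angle.two_nsmul_eq_pi_iff]
    have hre := P.sideVec_andreevSide_re
    have him : (P.sideVec P.andreevSide).im ≠ 0 := fun him =>
      P.sideVec_ne_zero _ (Complex.ext hre him)
    rcases him.lt_or_gt with him | him
    · exact .inr (congrArg _ ((Complex.arg_eq_neg_pi_div_two_iff.2 ⟨hre, him⟩).trans
        (neg_div _ _).symm))
    · exact .inl (congrArg _ (Complex.arg_eq_pi_div_two_iff.2 ⟨hre, him⟩))
  rw [reflectDir, hangle]

theorem reflectDir_sideAngle_minus (i : ZMod P.n) (θ : Real.Angle) :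
    reflectDir (P.sideAngle .minus i) θ = -reflectDir (P.sideAngle .plus i) (-θ) := by
  have hvec : P.vertexOf .minus (i + 1) - P.vertexOf .minus i =
      -starRingEnd ℂ (P.sideVec i) := by
    simp only [Complex.ext_iff, vertexOf, place, rho, PolygonalBilliard.sideVec, map_sub,
      Complex.sub_re, Complex.sub_im, Complex.neg_re, Complex.neg_im, Complex.conj_re,
      Complex.conj_im]
    constructor <;> ring
  have hne : starRingEnd ℂ (P.sideVec i) ≠ 0 := (map_ne_zero _).2 (P.sideVec_ne_zero i)
  have hminus : P.sideAngle .minus i = -P.sideAngle .plus i + Real.pi := by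
    rw [sideAngle, hvec, Complex.arg_neg_coe_angle hne, Complex.arg_conj_coe_angle]
    rfl
  rw [reflectDir, reflectDir, hminus, nsmul_add, smul_neg, Real.Angle.two_nsmul_coe_pi]
  abel

theorem lin_toCircle (i : ZMod P.n) (θ : Real.Angle) :
    P.lin i θ.toCircle = (reflectDir (P.sideAngle .plus i) θ).toCircle :=
  (PolygonalBilliard.lin_apply _).trans (toCircle_reflectDir_arg (P.sideVec_ne_zero i) θ).symm

theorem toCircle_add_pi (θ : Real.Angle) :
    ((θ + Real.pi : Real.Angle).toCircle : ℂ) = -θ.toCircle := by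
  simp

theorem isOfFinAddOrder_sideAngle (hP : P.IsRational) (i : ZMod P.n) :
    IsOfFinAddOrder (P.sideAngle .plus i) := by
  refine hP.isOfFinAddOrder_arg_sideVec (i₀ := P.andreevSide) ?_ i
  refine isOfFinAddOrder_iff_nsmul_eq_zero.2 ⟨4, by norm_num, ?_⟩
  have hangle := reflectDir_andreevSide (P := P) 0
  rw [reflectDir, sub_zero, sub_zero] at hangle
  change (2 * 2) • P.sideAngle .plus P.andreevSide = 0
  rw [mul_nsmul, hangle, Real.Angle.two_nsmul_coe_pi]

theorem finite_setOf_isDirectionFrom (hP : P.IsRational) (θ : Real.Angle) :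
    {φ | P.IsDirectionFrom θ φ}.Finite := by
  have : Fact (0 < 2 * Real.pi) := ⟨Real.two_pi_pos⟩
  set N := ∏ i, addOrderOf (P.sideAngle .plus i)
  have hNpos : 0 < N := Finset.prod_pos fun i _ => (isOfFinAddOrder_sideAngle hP i).addOrderOf_pos
  have hreflect (i : ZMod P.n) (φ : Real.Angle) :
      N • reflectDir (P.sideAngle .plus i) φ = -(N • φ) := by
    have hNi : N • P.sideAngle .plus i = 0 :=
      addOrderOf_dvd_iff_nsmul_eq_zero.1 (Finset.dvd_prod_of_mem _ (Finset.mem_univ i))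
    rw [reflectDir, nsmul_sub, nsmul_left_comm, hNi, nsmul_zero, zero_sub]
  have htorsion : {φ : Real.Angle | N • φ = 0}.Finite := AddCircle.finite_torsion _ hNpos
  refine ((htorsion.image (· + θ)).union (htorsion.image (· - θ))).subset fun φ hφ => ?_
  suffices h : N • φ = N • θ ∨ N • φ = -(N • θ) by
    refine h.imp (fun h => ⟨φ - θ, ?_, sub_add_cancel φ θ⟩)
      fun h => ⟨φ + θ, ?_, add_sub_cancel_right φ θ⟩
    · rw [mem_ofPred_eq, nsmul_sub, h, sub_self]
    · rw [mem_ofPred_eq, nsmul_add, h, neg_add_cancel]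
  induction hφ with
  | base => exact .inl rfl
  | side ε i ψ _ ih =>
    cases ε
    · rw [hreflect, neg_inj, neg_eq_iff_eq_neg]
      exact ih.symm
    · rw [reflectDir_sideAngle_minus, smul_neg, hreflect, smul_neg, neg_neg, neg_inj,
        neg_eq_iff_eq_neg]
      exact ih.symm
  | andreev ψ _ ih =>
    rw [andreevDir_eq_neg, smul_neg, neg_inj, neg_eq_iff_eq_neg]
    exact ih.symm

theorem IsDirectionFrom.pi_sub (h : P.IsDirectionFrom θ φ) :
    P.IsDirectionFrom θ (Real.pi - φ) := by
  rw [← reflectDir_andreevSide]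
  exact .side _ _ _ h

theorem IsDirectionFrom.add_pi (h : P.IsDirectionFrom θ φ) :
    P.IsDirectionFrom θ (φ + Real.pi) := by
  have := h.andreev.pi_sub
  rwa [andreevDir_eq_neg, sub_neg_eq_add, add_comm] at this

theorem IsDirectionFrom.generic (h : P.IsDirectionFrom θ φ) (hθ : P.Generic θ.toCircle) :
    P.Generic φ.toCircle := by
  have hneg {ψ : Real.Angle} (hψ : P.Generic ψ.toCircle) : P.Generic (-ψ).toCircle := by
    have := (hψ.lin P.andreevSide).neg
    rwa [lin_toCircle, ← toCircle_add_pi, reflectDir_andreevSide, sub_add_eq_add_sub,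
      Real.Angle.coe_pi_add_coe_pi, zero_sub] at this
  induction h with
  | base => exact hθ
  | side ε i ψ _ ih =>
    cases ε
    · exact lin_toCircle i ψ ▸ ih.lin i
    · rw [reflectDir_sideAngle_minus]
      exact hneg (lin_toCircle i (-ψ) ▸ (hneg ih).lin i)
  | andreev ψ _ ih =>
    rw [andreevDir_eq_neg]
    exact hneg ih

variable (P) in
/-- The finitely many directions that arise from a generic one in a rational billiard. -/
noncomputable def directionSet (hP : P.IsRational) (hθ : P.Generic θ.toCircle) :
    P.DirectionSet where
  dirs := (fun φ : Real.Angle => (φ.toCircle : ℂ)) '' {φ | P.IsDirectionFrom θ φ}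
  finite_dirs := (finite_setOf_isDirectionFrom hP θ).image _
  generic := by
    rintro _ ⟨φ, hφ, rfl⟩
    exact hφ.generic hθ
  lin_mem i := by
    rintro _ ⟨φ, hφ, rfl⟩
    exact ⟨_, .side .plus i φ hφ, (lin_toCircle i φ).symm⟩
  neg_mem := by
    rintro _ ⟨φ, hφ, rfl⟩
    exact ⟨_, hφ.add_pi, toCircle_add_pi φ⟩

end PolygonalAndreevBilliard

/-! ### Unfolding the second table -/

namespace PolygonalAndreevBilliard

variable {P : PolygonalAndreevBilliard} {ε : Parity} {z : ℂ} {θ : Real.Angle}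

theorem place_place (ε : Parity) (z : ℂ) : P.place ε (P.place ε z) = z := by
  cases ε
  exacts [rfl, rho_rho z]

theorem place_flip_rho (ε : Parity) (z : ℂ) : P.place ε.flip (P.rho z) = P.place ε z := by
  cases ε
  exacts [rho_rho z, rfl]

theorem mem_place_image_iff {S : Set ℂ} : z ∈ P.place ε '' S ↔ P.place ε z ∈ S :=
  ⟨by rintro ⟨w, hw, rfl⟩; rwa [place_place], fun h => ⟨_, h, place_place ε z⟩⟩

theorem continuous_place (ε : Parity) : Continuous (P.place ε) := by
  cases ε
  · exact continuous_id
  · have hrho : P.rho = fun z => (2 * P.axis : ℝ) - starRingEnd ℂ z := by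
      ext1 z
      apply Complex.ext <;> simp [rho]
    change Continuous P.rho
    rw [hrho]
    fun_prop

theorem mem_insideOf_iff : z ∈ P.insideOf ε ↔ P.place ε z ∈ interior P.table := by
  let e : ℂ ≃ₜ ℂ := ⟨⟨P.place ε, P.place ε, place_place ε, place_place ε⟩,
    continuous_place ε, continuous_place ε⟩
  rw [← mem_place_image_iff]
  exact (e.image_interior P.table).symm ▸ Iff.rfl

/-- The direction `θ` in the table of parity `ε`, as a unit vector, carried back to `Ω⁺`. -/
noncomputable def dirVec : Parity → Real.Angle → ℂ
  | .plus, θ => θ.toCircle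
  | .minus, θ => (Real.pi - θ : Real.Angle).toCircle

theorem dirVec_injective (ε : Parity) : Function.Injective (dirVec ε) := by
  have hinj {θ φ : Real.Angle} (h : (θ.toCircle : ℂ) = φ.toCircle) : θ = φ := by
    rw [← Real.Angle.arg_toCircle θ, h, Real.Angle.arg_toCircle]
  intro θ φ h
  cases ε
  exacts [hinj h, sub_right_injective (hinj h)]

theorem dirVec_add_pi (ε : Parity) (θ : Real.Angle) : dirVec ε (θ + Real.pi) = -dirVec ε θ := by
  cases ε
  · exact toCircle_add_pi θ
  · have hπ : Real.pi - (θ + Real.pi) + Real.pi = (Real.pi - θ : Real.Angle) := by abel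
    rw [dirVec, dirVec, ← hπ, toCircle_add_pi, neg_neg]

theorem dirVec_andreevDir (ε : Parity) (θ : Real.Angle) :
    dirVec ε.flip (andreevDir θ) = -dirVec ε θ := by
  rw [andreevDir_eq_neg, ← dirVec_add_pi]
  cases ε <;> simp only [dirVec, Parity.flip]
  · rw [sub_neg_eq_add, add_comm]
  · rw [sub_add_cancel_right]

theorem dirVec_reflectDir (ε : Parity) (i : ZMod P.n) (θ : Real.Angle) :
    dirVec ε (reflectDir (P.sideAngle ε i) θ) = P.lin i (dirVec ε θ) := by
  cases ε <;> simp only [dirVec, lin_toCircle]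
  rw [reflectDir_sideAngle_minus, reflectDir, reflectDir, sub_neg_eq_add, sub_neg_eq_add,
    sub_sub_eq_add_sub]
  rw [sub_eq_add_neg, Real.Angle.neg_coe_pi, add_comm]

theorem place_add_smul (ε : Parity) (z : ℂ) (s : ℝ) (θ : Real.Angle) :
    P.place ε (z + s * (θ.toCircle : ℂ)) = P.place ε z + s • dirVec ε θ := by
  cases ε
  · simp only [place, dirVec, Complex.real_smul]
  · have hvec : dirVec .minus θ = -starRingEnd ℂ θ.toCircle := by
      rw [dirVec, sub_eq_neg_add, toCircle_add_pi, Real.Angle.toCircle_neg, Circle.coe_inv_eq_conj]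
    rw [hvec]
    apply Complex.ext
    · simp only [place, rho, Complex.add_re, Complex.re_ofReal_mul, Complex.real_smul,
        Complex.neg_re, Complex.conj_re]
      ring
    · simp [place, rho]

theorem IsDirectionFrom.dirVec_mem_directionSet {φ : Real.Angle} {hP : P.IsRational}
    {hθ : P.Generic θ.toCircle} (h : P.IsDirectionFrom θ φ) (ε : Parity) :
    dirVec ε φ ∈ (P.directionSet hP hθ).dirs := by
  cases ε
  exacts [⟨φ, h, rfl⟩, ⟨_, h.pi_sub, rfl⟩]

namespace State

/-- The position of a state, carried back to `Ω⁺`. -/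
def base (p : P.State) : ℂ := P.place p.parity p.pos

/-- The direction of a state, as a unit vector, carried back to `Ω⁺`. -/
noncomputable def vec (p : P.State) : ℂ := dirVec p.parity p.dir

theorem base_mem (p : P.State) : p.base ∈ P.table := mem_place_image_iff.1 p.pos_mem

theorem pos_eq_iff {p : P.State} : p.pos = z ↔ p.base = P.place p.parity z :=
  (place_injective _).eq_iff.symm

theorem dir_eq_iff {p : P.State} : p.dir = θ ↔ p.vec = dirVec p.parity θ :=
  (dirVec_injective _).eq_iff.symm

theorem ext_base {p q : P.State} (hparity : p.parity = q.parity) (hbase : p.base = q.base)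
    (hvec : p.vec = q.vec) : p = q :=
  State.ext hparity (pos_eq_iff.2 (hparity ▸ hbase)) (dir_eq_iff.2 (hparity ▸ hvec))

end State

variable {p q w : P.State} {s : ℝ}

theorem rel_iff : Rel p q ↔ p = q ∨
    (q.parity = p.parity ∧ q.base = p.base ∧ p.base ∉ P.andreevSegment ∧
      ∃ i, p.base ∈ P.openSide i ∧ q.vec = P.lin i p.vec) ∨
    (q.parity = p.parity.flip ∧ q.base = p.base ∧ p.base ∈ P.andreevSegment ∧
      q.vec = -p.vec) := by
  constructor
  · rintro (_ | ⟨_, i, hparity, hpos, hside, hA, hdir⟩ | ⟨_, hparity, hpos, hA, hdir⟩)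
    · exact .inl rfl
    · rw [State.pos_eq_iff, hparity] at hpos
      rw [State.dir_eq_iff, hparity, dirVec_reflectDir] at hdir
      exact .inr (.inl ⟨hparity, hpos, mem_place_image_iff.not.1 hA, i,
        mem_place_image_iff.1 hside, hdir⟩)
    · rw [State.pos_eq_iff, hparity, place_flip_rho] at hpos
      rw [State.dir_eq_iff, hparity, dirVec_andreevDir] at hdir
      exact .inr (.inr ⟨hparity, hpos, mem_place_image_iff.1 hA, hdir⟩)
  · rintro (rfl | ⟨hparity, hbase, hA, i, hside, hvec⟩ | ⟨hparity, hbase, hA, hvec⟩)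
    · exact .refl _
    · refine .side _ _ i hparity ?_ (mem_place_image_iff.2 hside) (mem_place_image_iff.not.2 hA) ?_
      · rwa [State.pos_eq_iff, hparity]
      · rwa [State.dir_eq_iff, hparity, dirVec_reflectDir]
    · refine .andreev _ _ hparity ?_ (mem_place_image_iff.2 hA) ?_
      · rwa [State.pos_eq_iff, hparity, place_flip_rho]
      · rwa [State.dir_eq_iff, hparity, dirVec_andreevDir]

theorem Rel.base_eq (h : Rel p q) : q.base = p.base := by
  rcases rel_iff.1 h with rfl | h | h
  exacts [rfl, h.2.1, h.2.1]

theorem freeMotion_iff : FreeMotion p s w ↔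
    w.parity = p.parity ∧ w.vec = p.vec ∧ w.base = p.base + s • p.vec ∧
      w.base ∈ interior P.table := by
  refine and_congr_right fun hparity => ?_
  rw [State.dir_eq_iff, State.pos_eq_iff, mem_insideOf_iff, hparity, place_add_smul]
  simp only [State.base, State.vec, hparity]

theorem toPhase_eq_iff : toPhase p = toPhase q ↔ Rel p q := Quotient.eq (r := P.stateSetoid)

theorem exists_toPhase (x : P.PhaseSpace) : ∃ p : P.State, toPhase p = x := Quotient.exists_rep x

theorem atCorner_toPhase : AtCorner (toPhase p) ↔ p.base ∈ range P.vertex := by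
  have hcorner (q : P.State) : q.pos ∈ range (P.vertexOf q.parity) ↔ q.base ∈ range P.vertex := by
    rw [State.base, ← mem_place_image_iff, ← range_comp]
    rfl
  constructor
  · rintro ⟨q, hq, hcorner_q⟩
    rw [(toPhase_eq_iff.1 hq).base_eq]
    exact (hcorner q).1 hcorner_q
  · exact fun hp => ⟨p, rfl, (hcorner p).2 hp⟩

theorem Rel.eq_of_mem_interior (h : Rel p q) (hp : p.base ∈ interior P.table) : p = q := by
  rcases rel_iff.1 h with h | ⟨-, -, -, i, hside, -⟩ | ⟨-, -, hA, -⟩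
  · exact h
  · exact absurd hp (PolygonalBilliard.openSide_subset_frontier hside).2
  · exact absurd hp (P.andreevSegment_subset hA).1.2

/-- The state moves into the interior of its table. -/
def Inward (p : P.State) : Prop := ∀ᶠ s in 𝓝[>] (0 : ℝ), p.base + s • p.vec ∈ interior P.table

theorem Inward.inward_pos (h : Inward p) {i : ZMod P.n} (hi : p.base ∈ P.openSide i) :
    0 < P.inward i p.vec := by
  obtain ⟨s, ⟨hs, hs0⟩, hiff⟩ := ((h.and self_mem_nhdsWithin).and (nhdsWithin_le_nhds
    (PolygonalBilliard.eventually_add_smul_mem_interior_iff hi p.vec))).exists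
  exact pos_of_mul_pos_right (hiff.1 hs) hs0.le

theorem Rel.eq_of_inward (h : Rel p q) (hp : Inward p) (hq : Inward q) : p = q := by
  rcases rel_iff.1 h with h | ⟨-, hbase, -, i, hi, hvec⟩ | ⟨-, hbase, hA, hvec⟩
  · exact h
  · have hneg := hq.inward_pos (hbase ▸ hi)
    rw [hvec, PolygonalBilliard.inward_lin] at hneg
    exact absurd (hp.inward_pos hi) (neg_pos.1 hneg).not_gt
  · have hi := andreevSegment_subset_openSide hA
    have hneg := hq.inward_pos (hbase ▸ hi)
    rw [hvec, map_neg] at hneg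
    exact absurd (hp.inward_pos hi) (neg_pos.1 hneg).not_gt

end PolygonalAndreevBilliard

/-! ### Uniqueness of flow lines -/

namespace PolygonalAndreevBilliard

variable {P : PolygonalAndreevBilliard} {p p' q w w' : P.State} {c c' : ℝ → P.PhaseSpace}
  {a b s t : ℝ} {l : Filter ℝ} {z : ℂ}

theorem FreeMotion.right_unique (h : FreeMotion p s w) (h' : FreeMotion p s w') : w = w' := by
  rw [freeMotion_iff] at h h'
  exact State.ext_base (h.1.trans h'.1.symm) (h.2.2.1.trans h'.2.2.1.symm) (h.2.1.trans h'.2.1.symm)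

theorem FreeMotion.left_unique (h : FreeMotion p s w) (h' : FreeMotion q s w) : p = q := by
  rw [freeMotion_iff] at h h'
  have hvec : p.vec = q.vec := h.2.1.symm.trans h'.2.1
  refine State.ext_base (h.1.symm.trans h'.1) ?_ hvec
  have hbase := h.2.2.1.symm.trans h'.2.2.1
  rwa [hvec, add_left_inj] at hbase

/-- The curve `c` is free motion of the representative `p` of `c t` at the times close to `t` that
the filter `l` sees: `l = 𝓝[>] t` is departure along `p`, and `l = 𝓝[<] t` is arrival along `p`. -/
def FollowsAt (c : ℝ → P.PhaseSpace) (t : ℝ) (l : Filter ℝ) (p : P.State) : Prop :=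
  toPhase p = c t ∧ ∀ᶠ s in l, ∃ w, toPhase w = c s ∧ FreeMotion p (s - t) w

theorem FollowsAt.inward (h : FollowsAt c t (𝓝[>] t) p) : Inward p := by
  have hmotion := h.2
  rw [← add_zero t, ← map_add_left_nhdsGT, eventually_map] at hmotion
  filter_upwards [hmotion] with s ⟨w, _, hw⟩
  obtain ⟨-, -, hbase, hmem⟩ := freeMotion_iff.1 hw
  rwa [hbase, add_zero, add_sub_cancel_left] at hmem

theorem FollowsAt.eventuallyEq (h : FollowsAt c t (𝓝[>] t) p) (h' : FollowsAt c' t (𝓝[>] t) p')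
    (ht : c t = c' t) : c =ᶠ[𝓝[>] t] c' := by
  obtain rfl : p = p' :=
    (toPhase_eq_iff.1 (h.1.trans (ht.trans h'.1.symm))).eq_of_inward h.inward h'.inward
  filter_upwards [h.2, h'.2] with s ⟨w, hw, hpw⟩ ⟨w', hw', hpw'⟩
  rw [← hw, ← hw', hpw.right_unique hpw']

theorem FollowsAt.eq_of_frequently_eq (h : FollowsAt c t l p) (h' : FollowsAt c' t l p')
    (hl : ∃ᶠ s in l, c s = c' s) : c t = c' t := by
  obtain ⟨s, hs, ⟨w, hw, hpw⟩, w', hw', hpw'⟩ := (hl.and_eventually (h.2.and h'.2)).exists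
  obtain rfl : w = w' := (toPhase_eq_iff.1 (hw.trans (hs.trans hw'.symm))).eq_of_mem_interior
    (freeMotion_iff.1 hpw).2.2.2
  rw [← h.1, ← h'.1, hpw.left_unique hpw']

/-- The curve `c` obeys the rule of motion of the Andreev flow between the times `a` and `b`. -/
def FlowsOn (c : ℝ → P.PhaseSpace) (a b : ℝ) : Prop :=
  (∀ t ∈ Ico a b, ∃ p, FollowsAt c t (𝓝[>] t) p) ∧ ∀ t ∈ Ioc a b, ∃ p, FollowsAt c t (𝓝[<] t) p

theorem IsFlowLine.exists_departure (h : IsFlowLine c) (t : ℝ) :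
    ∃ p, FollowsAt c t (𝓝[>] t) p := by
  obtain ⟨-, p, -, hp, -, δ, hδ, hdeparture, -⟩ := h t
  refine ⟨p, hp, ?_⟩
  filter_upwards [Ioo_mem_nhdsGT (lt_add_of_pos_right t hδ)] with s hs
  simpa only [add_sub_cancel] using hdeparture (s - t) ⟨sub_pos.2 hs.1, sub_left_lt_of_lt_add hs.2⟩

theorem IsFlowLine.exists_arrival (h : IsFlowLine c) (t : ℝ) : ∃ p, FollowsAt c t (𝓝[<] t) p := by
  obtain ⟨-, -, q, -, hq, δ, hδ, -, harrival⟩ := h t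
  refine ⟨q, hq, ?_⟩
  filter_upwards [Ioo_mem_nhdsLT (sub_lt_self t hδ)] with s hs
  simpa only [add_sub_cancel] using
    harrival (s - t) ⟨by linarith only [hs.1], sub_neg.2 hs.2⟩

theorem IsFlowLine.flowsOn (h : IsFlowLine c) (a b : ℝ) : FlowsOn c a b :=
  ⟨fun t _ => h.exists_departure t, fun t _ => h.exists_arrival t⟩

theorem FlowsOn.eqOn (h : FlowsOn c a b) (h' : FlowsOn c' a b) (ha : c a = c' a) :
    EqOn c c' (Icc a b) := by
  refine IsClosed.Icc_subset_of_forall_mem_nhdsWithin (s := {t | c t = c' t}) ?_ ha ?_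
  · refine isClosed_iff_frequently.2 fun t ht => ?_
    have htab : t ∈ Icc a b :=
      isClosed_iff_frequently.1 isClosed_Icc t (ht.mono fun s hs => hs.2)
    refine ⟨by_contra fun hne => ?_, htab⟩
    have ht' : ∃ᶠ s in 𝓝[≠] t, s ∈ {t | c t = c' t} ∩ Icc a b := by
      refine frequently_nhdsWithin_iff.2 (ht.mono fun s hs => ⟨hs, ?_⟩)
      rintro rfl
      exact hne hs.1
    rw [← nhdsLT_sup_nhdsGT, frequently_sup] at ht'
    rcases ht' with ht' | ht'
    · obtain ⟨s, hs, hst⟩ := (ht'.and_eventually self_mem_nhdsWithin).exists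
      obtain ⟨p, hp⟩ := h.2 t ⟨hs.2.1.trans_lt hst, htab.2⟩
      obtain ⟨p', hp'⟩ := h'.2 t ⟨hs.2.1.trans_lt hst, htab.2⟩
      exact hne (hp.eq_of_frequently_eq hp' (ht'.mono fun s hs => hs.1))
    · obtain ⟨s, hs, hst⟩ := (ht'.and_eventually self_mem_nhdsWithin).exists
      obtain ⟨p, hp⟩ := h.1 t ⟨htab.1, lt_of_lt_of_le hst hs.2.2⟩
      obtain ⟨p', hp'⟩ := h'.1 t ⟨htab.1, lt_of_lt_of_le hst hs.2.2⟩
      exact hne (hp.eq_of_frequently_eq hp' (ht'.mono fun s hs => hs.1))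
  · rintro t ⟨ht, htab⟩
    obtain ⟨p, hp⟩ := h.1 t htab
    obtain ⟨p', hp'⟩ := h'.1 t htab
    exact hp.eventuallyEq hp' ht

theorem IsFlowLine.eq_of_le (h : IsFlowLine c) (h' : IsFlowLine c') (ha : c a = c' a)
    (hat : a ≤ t) : c t = c' t :=
  (h.flowsOn a t).eqOn (h'.flowsOn a t) ha (right_mem_Icc.2 hat)

open Classical in
/-- The state `p` moved along its direction for the time `s`, and the junk value `p` if this leads
out of the table. -/
noncomputable def State.move (p : P.State) (s : ℝ) : P.State :=
  if h : p.base + s • p.vec ∈ P.table then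
    { p with
      pos := P.place p.parity (p.base + s • p.vec)
      pos_mem := ⟨_, h, rfl⟩ }
  else p

theorem State.parity_move (p : P.State) (s : ℝ) : (p.move s).parity = p.parity := by
  unfold move
  split_ifs <;> rfl

theorem State.vec_move (p : P.State) (s : ℝ) : (p.move s).vec = p.vec := by
  unfold move
  split_ifs <;> rfl

theorem State.base_move (h : p.base + s • p.vec ∈ P.table) :
    (p.move s).base = p.base + s • p.vec := by
  rw [move, dif_pos h]
  exact place_place _ _

theorem freeMotion_move (hs : p.base + s • p.vec ∈ P.table)
    (ht : p.base + t • p.vec ∈ interior P.table) : FreeMotion (p.move s) (t - s) (p.move t) := by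
  rw [freeMotion_iff, State.base_move hs, State.base_move (interior_subset ht)]
  simp only [State.parity_move, State.vec_move, ht, and_true, true_and]
  module

theorem flowsOn_move {τ : ℝ} (hinterior : ∀ s ∈ Ioo 0 τ, p.base + s • p.vec ∈ interior P.table)
    (hτ : p.base + τ • p.vec ∈ P.table) (a : ℝ) :
    FlowsOn (fun t => toPhase (p.move (t - a))) a (a + τ) := by
  have htable : ∀ s ∈ Icc 0 τ, p.base + s • p.vec ∈ P.table := by
    rintro s hs
    rcases hs.1.eq_or_lt with rfl | hs0
    · simpa only [zero_smul, add_zero] using p.base_mem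
    rcases hs.2.eq_or_lt with rfl | hsτ
    · exact hτ
    · exact interior_subset (hinterior s ⟨hs0, hsτ⟩)
  have hfollows {t s : ℝ} (ht : t ∈ Icc a (a + τ)) (hs : s ∈ Ioo a (a + τ)) :
      ∃ w, toPhase w = toPhase (p.move (s - a)) ∧ FreeMotion (p.move (t - a)) (s - t) w := by
    have := freeMotion_move (htable (t - a) ⟨sub_nonneg.2 ht.1, sub_left_le_of_le_add ht.2⟩)
      (hinterior (s - a) ⟨sub_pos.2 hs.1, sub_left_lt_of_lt_add hs.2⟩)
    exact ⟨_, rfl, by rwa [sub_sub_sub_cancel_right] at this⟩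
  refine ⟨fun t ht => ⟨_, rfl, ?_⟩, fun t ht => ⟨_, rfl, ?_⟩⟩
  · filter_upwards [Ioo_mem_nhdsGT ht.2] with s hs
    exact hfollows (Ico_subset_Icc_self ht) ⟨ht.1.trans_lt hs.1, hs.2⟩
  · filter_upwards [Ioo_mem_nhdsLT ht.1] with s hs
    exact hfollows (Ioc_subset_Icc_self ht) ⟨hs.1, hs.2.trans_le ht.2⟩

theorem IsFlowLine.exists_of_flight (hc : IsFlowLine c) (hp : toPhase p = c a)
    (h : P.Flight p.vec p.base z) (hz : z ∈ P.table) :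
    ∃ b > a, ∃ q, toPhase q = c b ∧ q.base = z ∧ q.vec = p.vec := by
  obtain ⟨τ, hτ, rfl, hinterior⟩ := h
  have hbase : (p.move 0).base = p.base := by
    rw [State.base_move] <;> rw [zero_smul, add_zero]
    exact p.base_mem
  have hstart : c a = toPhase (p.move (a - a)) := by
    rw [← hp, sub_self, State.ext_base (p.parity_move 0) hbase (p.vec_move 0)]
  refine ⟨a + τ, lt_add_of_pos_right a hτ, p.move τ, ?_, State.base_move hz, p.vec_move τ⟩
  have := (hc.flowsOn a (a + τ)).eqOn (flowsOn_move hinterior hz a) hstart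
    (right_mem_Icc.2 (le_add_of_nonneg_right hτ.le))
  simpa only [add_sub_cancel_left] using this.symm

end PolygonalAndreevBilliard

/-! ### Time-reversing symmetries and periodicity -/

namespace PolygonalAndreevBilliard

variable {P : PolygonalAndreevBilliard} {p q w : P.State} {c c' : ℝ → P.PhaseSpace}
  {x : P.PhaseSpace} {a b s t : ℝ} {z : ℂ}

/-- The base point of the class `x` lies in the Andreev subset. -/
def AtAndreev (x : P.PhaseSpace) : Prop :=
  ∃ p : P.State, toPhase p = x ∧ p.base ∈ P.andreevSegment

theorem atAndreev_toPhase : AtAndreev (toPhase p) ↔ p.base ∈ P.andreevSegment := by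
  constructor
  · rintro ⟨q, hq, hA⟩
    rwa [(toPhase_eq_iff.1 hq).base_eq]
  · exact fun hA => ⟨p, rfl, hA⟩

/-- A transformation of the states that fixes the position, carried back to `Ω⁺`, and turns the
direction by a half turn. It induces a symmetry of the flow that reverses time. -/
structure Reversal (P : PolygonalAndreevBilliard) where
  map : P.State → P.State
  onParity : Parity → Parity
  onParity_flip : ∀ ε, onParity ε.flip = (onParity ε).flip
  parity_map : ∀ p, (map p).parity = onParity p.parity
  base_map : ∀ p, (map p).base = p.base
  vec_map : ∀ p, (map p).vec = -p.vec

namespace Reversal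

variable (F : Reversal P)

theorem rel_map (h : Rel p q) : Rel (F.map p) (F.map q) := by
  rw [rel_iff] at h ⊢
  simp only [F.parity_map, F.base_map, F.vec_map, map_neg, neg_inj, ← F.onParity_flip]
  rcases h with rfl | ⟨hparity, h⟩ | ⟨hparity, h⟩
  · exact .inl rfl
  · exact .inr (.inl ⟨congrArg _ hparity, h⟩)
  · exact .inr (.inr ⟨congrArg _ hparity, h⟩)

/-- The transformation that a reversal induces on the phase space. -/
def onPhase : P.PhaseSpace → P.PhaseSpace :=
  Quotient.map (sa := P.stateSetoid) (sb := P.stateSetoid) F.map fun _ _ h => F.rel_map h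

theorem onPhase_toPhase (p : P.State) : F.onPhase (toPhase p) = toPhase (F.map p) := rfl

theorem atCorner_onPhase : AtCorner (F.onPhase x) ↔ AtCorner x := by
  obtain ⟨p, rfl⟩ := exists_toPhase x
  rw [onPhase_toPhase, atCorner_toPhase, atCorner_toPhase, F.base_map]

theorem atAndreev_onPhase : AtAndreev (F.onPhase x) ↔ AtAndreev x := by
  obtain ⟨p, rfl⟩ := exists_toPhase x
  rw [onPhase_toPhase, atAndreev_toPhase, atAndreev_toPhase, F.base_map]

theorem freeMotion_map (h : FreeMotion p s w) : FreeMotion (F.map p) (-s) (F.map w) := by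
  rw [freeMotion_iff] at h ⊢
  rw [F.parity_map, F.parity_map, F.vec_map, F.vec_map, F.base_map, F.base_map, neg_smul_neg]
  exact ⟨congrArg _ h.1, congrArg _ h.2.1, h.2.2⟩

theorem isFlowLine (h : IsFlowLine c) (a : ℝ) : IsFlowLine fun t => F.onPhase (c (a - t)) := by
  intro t
  obtain ⟨hcorner, p, q, hp, hq, δ, hδ, hdeparture, harrival⟩ := h (a - t)
  have hmap {p w : P.State} {s : ℝ} (hw : toPhase w = c (a - t + -s)) (h : FreeMotion p (-s) w) :
      ∃ w', toPhase w' = F.onPhase (c (a - (t + s))) ∧ FreeMotion (F.map p) s w' := by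
    refine ⟨F.map w, ?_, neg_neg s ▸ F.freeMotion_map h⟩
    rw [← onPhase_toPhase, hw, ← sub_sub, sub_eq_add_neg _ s]
  refine ⟨F.atCorner_onPhase.not.2 hcorner, F.map q, F.map p, congrArg F.onPhase hq,
    congrArg F.onPhase hp, δ, hδ, fun s hs => ?_, fun s hs => ?_⟩
  · obtain ⟨w, hw, hqw⟩ := harrival (-s) ⟨neg_lt_neg hs.2, neg_neg_iff_pos.2 hs.1⟩
    exact hmap hw hqw
  · obtain ⟨w, hw, hpw⟩ := hdeparture (-s) ⟨neg_pos.2 hs.2, neg_lt.1 hs.1⟩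
    exact hmap hw hpw

end Reversal

/-- Time reversal `(x, θ) ↦ (x, θ + π)`. -/
noncomputable def timeReversal : Reversal P where
  map p := { p with dir := p.dir + Real.pi }
  onParity := id
  onParity_flip _ := rfl
  parity_map _ := rfl
  base_map _ := rfl
  vec_map _ := dirVec_add_pi _ _

/-- The Andreev retroreflection `(x, θ) ↦ (ρ(x), r(θ) + π)`, which exchanges the tables. -/
noncomputable def retroreflection : Reversal P where
  map p := ⟨p.parity.flip, P.place p.parity.flip p.base, andreevDir p.dir, ⟨_, p.base_mem, rfl⟩⟩
  onParity := Parity.flip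
  onParity_flip _ := rfl
  parity_map _ := rfl
  base_map _ := place_place _ _
  vec_map _ := dirVec_andreevDir _ _

theorem timeReversal_involutive : Function.Involutive (timeReversal (P := P)).onPhase := by
  intro x
  obtain ⟨p, rfl⟩ := exists_toPhase x
  rw [Reversal.onPhase_toPhase, Reversal.onPhase_toPhase]
  congr 1
  refine State.ext_base rfl rfl ?_
  rw [Reversal.vec_map, Reversal.vec_map, neg_neg]

theorem IsFlowLine.eq (h : IsFlowLine c) (h' : IsFlowLine c') (ha : c a = c' a) : c = c' := by
  ext1 t
  rcases le_total a t with hat | hta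
  · exact h.eq_of_le h' ha hat
  · refine timeReversal_involutive.injective ?_
    have := (timeReversal.isFlowLine h 0).eq_of_le (timeReversal.isFlowLine h' 0) (a := -a)
      (by simp only [zero_sub, neg_neg, ha]) (neg_le_neg hta)
    simpa only [zero_sub, neg_neg] using this

theorem AtAndreev.retroreflection_eq (h : AtAndreev x) : retroreflection.onPhase x = x := by
  obtain ⟨p, rfl, hp⟩ := h
  rw [Reversal.onPhase_toPhase, toPhase_eq_iff]
  exact (rel_iff.2 (.inr (.inr
    ⟨rfl, Reversal.base_map _ _, hp, Reversal.vec_map _ _⟩))).symm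

theorem IsFlowLine.eq_retroreflection (h : IsFlowLine c) (ha : AtAndreev (c a)) (t : ℝ) :
    c t = retroreflection.onPhase (c (2 * a - t)) := by
  refine congrFun (h.eq (retroreflection.isFlowLine h (2 * a)) (a := a) ?_) t
  rw [two_mul, add_sub_cancel_right, ha.retroreflection_eq]

theorem IsFlowLine.periodic (h : IsFlowLine c) (ha : AtAndreev (c a)) (hb : AtAndreev (c b)) :
    Function.Periodic c (2 * (b - a)) := by
  intro t
  rw [h.eq_retroreflection hb, h.eq_retroreflection ha t]
  congr 2
  ring

theorem exists_mem_openSide_andreevSide_eventually : ∃ z ∈ P.openSide P.andreevSide,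
    ∀ᶠ w in 𝓝 z, w ∈ P.openSide P.andreevSide → w ∈ P.andreevSegment := by
  have hre {z w : ℂ} (hz : z ∈ P.openSide P.andreevSide) (hw : w ∈ P.openSide P.andreevSide) :
      z.re = w.re := by
    obtain ⟨r, -, rfl⟩ := PolygonalBilliard.mem_openSide_iff.1 hz
    obtain ⟨s, -, rfl⟩ := PolygonalBilliard.mem_openSide_iff.1 hw
    simp [sideVec_andreevSide_re]
  have him : (Complex.im '' P.andreevSegment).OrdConnected :=
    (P.andreevSegment_connected.isPreconnected.image _
      Complex.continuous_im.continuousOn).ordConnected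
  obtain ⟨a, ha, b, hb, hab⟩ : ∃ a ∈ P.andreevSegment, ∃ b ∈ P.andreevSegment, a.im < b.im := by
    obtain ⟨a, ha, b, hb, hne⟩ := P.andreevSegment_nontrivial
    rcases lt_trichotomy a.im b.im with hlt | heq | hgt
    · exact ⟨a, ha, b, hb, hlt⟩
    · exact absurd (Complex.ext (P.andreevSegment_vertical a ha b hb) heq) hne
    · exact ⟨b, hb, a, ha, hgt⟩
  have hbetween {y : ℝ} (hy : y ∈ Ioo a.im b.im) : ∃ z ∈ P.andreevSegment, z.im = y :=
    him.out (mem_image_of_mem _ ha) (mem_image_of_mem _ hb) (Ioo_subset_Icc_self hy)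
  obtain ⟨y, hy⟩ := exists_between hab
  obtain ⟨z, hz, rfl⟩ := hbetween hy
  refine ⟨z, andreevSegment_subset_openSide hz, ?_⟩
  filter_upwards [Complex.continuous_im.continuousAt.preimage_mem_nhds (Ioo_mem_nhds hy.1 hy.2)]
    with w hw hside
  obtain ⟨v, hv, hvw⟩ := hbetween hw
  exact Complex.ext (hre (andreevSegment_subset_openSide hv) hside) hvw ▸ hv

open PolygonalBilliard PolygonalBilliard.DirectionSet

variable {D : P.DirectionSet} {x y : D.Label × ℝ} {d : D.Label}

/-- At the time `t` the flow line `c` leaves the side of `d` at `z` in the direction of `d`. -/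
def LeavesSide (c : ℝ → P.PhaseSpace) (t : ℝ) (d : D.Label) (z : ℂ) : Prop :=
  z ∈ P.openSide d.side ∧ ∃ p, toPhase p = c t ∧ p.base = z ∧ p.vec = d.dir

theorem IsFlowLine.exists_leavesSide (hc : IsFlowLine c) (hA : ∀ t > a, ¬ AtAndreev (c t))
    (hp : toPhase p = c a) (hdir : p.vec ∈ D.dirs) (h : P.Flight p.vec p.base z)
    (hz : z ∈ frontier P.table) :
    ∃ b > a, ∃ d : D.Label, d.dir = P.lin d.side p.vec ∧ LeavesSide c b d z := by
  obtain ⟨b, hb, q, hq, rfl, hvec⟩ := hc.exists_of_flight hp h (P.frontier_subset_table hz)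
  rcases mem_frontier_iff.1 hz with hcorner | ⟨i, hi⟩
  · exact absurd (hq ▸ atCorner_toPhase.2 hcorner) (hc b).1
  let q' : P.State := { q with dir := reflectDir (P.sideAngle q.parity i) q.dir }
  have hvec' : q'.vec = P.lin i q.vec := dirVec_reflectDir _ _ _
  have hqA : q.base ∉ P.andreevSegment := atAndreev_toPhase.not.1 (hq ▸ hA b hb)
  have hrel : Rel q q' := rel_iff.2 (.inr (.inl ⟨rfl, rfl, hqA, i, hi, hvec'⟩))
  have hpos : 0 < P.inward i (P.lin i p.vec) := by
    rw [inward_lin]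
    exact neg_pos.2 (h.inward_neg hi)
  exact ⟨b, hb, ⟨i, P.lin i p.vec, D.lin_mem i hdir, hpos⟩, rfl, hi, q',
    (toPhase_eq_iff.2 hrel).symm.trans hq, rfl, hvec'.trans (hvec.symm ▸ rfl)⟩

theorem IsFlowLine.exists_leavesSide_start (hc : IsFlowLine c) (hA : ∀ t > a, ¬ AtAndreev (c t))
    (hp : toPhase p = c a) (hdir : p.vec ∈ D.dirs) :
    ∃ b > a, ∃ (d : D.Label) (z : ℂ), LeavesSide c b d z := by
  obtain ⟨q, hq⟩ := hc.exists_departure a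
  have hqdir : q.vec ∈ D.dirs := by
    rcases rel_iff.1 (toPhase_eq_iff.1 (hp.trans hq.1.symm)) with
      rfl | ⟨-, -, -, i, -, hvec⟩ | ⟨-, -, -, hvec⟩
    · exact hdir
    · exact hvec ▸ D.lin_mem i hdir
    · exact hvec ▸ D.neg_mem hdir
  obtain ⟨z, hz, hflight⟩ := exists_flight (D.generic hqdir).1 hq.inward
  obtain ⟨b, hb, d, -, hd⟩ := hc.exists_leavesSide hA hq.1 hqdir hflight hz
  exact ⟨b, hb, d, z, hd⟩

theorem IsFlowLine.exists_bounce (hc : IsFlowLine c) (hA : ∀ t > a, ¬ AtAndreev (c t))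
    (hx : LeavesSide c a x.1 (x.1.point x.2)) :
    ∃ b > a, ∃ y, Bounce x y ∧ LeavesSide c b y.1 (y.1.point y.2) := by
  obtain ⟨hside, p, hp, hbase, hvec⟩ := hx
  obtain ⟨z, hz, hflight⟩ := exists_flight_of_mem_openSide hside x.1.inward_pos
  obtain ⟨b, hb, d, hd, hleaves⟩ := hc.exists_leavesSide (D := D) hA hp (hvec ▸ x.1.dir_mem)
    (hvec ▸ hbase ▸ hflight) hz
  have hpoint : d.point (wedge d.dir z) = z := d.point_wedge hleaves.1
  exact ⟨b, hb, (d, wedge d.dir z),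
    ⟨hside, hpoint.symm ▸ hleaves.1, hvec ▸ hd, hpoint.symm ▸ hflight⟩, hpoint.symm ▸ hleaves⟩

theorem IsFlowLine.exists_leavesSide_of_reflTransGen (hc : IsFlowLine c)
    (hA : ∀ t > 0, ¬ AtAndreev (c t)) (ha : 0 < a) (hx : LeavesSide c a x.1 (x.1.point x.2))
    (hxy : Relation.ReflTransGen Bounce x y) :
    ∃ b > 0, LeavesSide c b y.1 (y.1.point y.2) := by
  induction hxy with
  | refl => exact ⟨a, ha, hx⟩
  | tail _ hyz ih =>
    obtain ⟨b, hb, hy⟩ := ih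
    obtain ⟨b', hb', z', hyz', hz'⟩ := hc.exists_bounce (fun t ht => hA t (hb.trans ht)) hy
    exact ⟨b', hb.trans hb', D.bounceMap.right_unique hyz hyz' ▸ hz'⟩

theorem IsFlowLine.exists_atAndreev (hc : IsFlowLine c) (hp : toPhase p = c 0)
    (hdir : p.vec ∈ D.dirs) : ∃ t > 0, AtAndreev (c t) := by
  by_contra! hA
  obtain ⟨a, ha, d, z, hleaves⟩ := hc.exists_leavesSide_start hA hp hdir
  set x : D.Label × ℝ := (d, wedge d.dir z)
  have hx : LeavesSide c a x.1 (x.1.point x.2) := (d.point_wedge hleaves.1).symm ▸ hleaves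
  have horbit {y} := hc.exists_leavesSide_of_reflTransGen hA ha hx (y := y)
  have hforward (y) (hxy : Relation.ReflTransGen Bounce x y) : ∃ z, Bounce y z := by
    obtain ⟨b, hb, hy⟩ := horbit hxy
    obtain ⟨-, -, z, hyz, -⟩ := hc.exists_bounce (fun t ht => hA t (hb.trans ht)) hy
    exact ⟨z, hyz⟩
  obtain ⟨w, hw, hwA⟩ := P.exists_mem_openSide_andreevSide_eventually
  obtain ⟨-, hy, y, ⟨hxy, hside⟩, rfl⟩ := mem_closure_iff_nhds.1
    (openSide_subset_closure_orbit hforward P.andreevSide hw) _ hwA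
  obtain ⟨b, hb, hmem, q, hq, hbase, -⟩ := horbit hxy
  exact hA b hb ⟨q, hq, hbase ▸ hy (hside ▸ hmem)⟩

end PolygonalAndreevBilliard

/-- For every rational polygonal Andreev billiard and Lebesgue-almost every direction `θ`, the flow
restricted to the invariant surface `M±_θ` is closed. -/
theorem mainTheorem2 (P : PolygonalAndreevBilliard) (hP : P.toPolygonalBilliard.IsRational) :
    ∀ᵐ θ : ℝ ∂volume,
      PolygonalAndreevBilliard.FlowIsClosedOn (P.invariantSurface (θ : Real.Angle)) := by
  filter_upwards [P.ae_generic] with θ hθ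
  rintro c hc ⟨p, hp, hpc⟩
  have hdir : p.vec ∈ (P.directionSet hP hθ).dirs := hp.dirVec_mem_directionSet p.parity
  let R : PolygonalAndreevBilliard.Reversal P := PolygonalAndreevBilliard.timeReversal
  obtain ⟨b, hb, hbA⟩ := hc.exists_atAndreev hpc hdir
  obtain ⟨a, ha, haA⟩ := (R.isFlowLine hc 0).exists_atAndreev (p := R.map p)
    (by rw [← R.onPhase_toPhase, hpc, sub_zero])
    (by rw [R.vec_map]; exact (P.directionSet hP hθ).neg_mem hdir)
  exact ⟨2 * (b - (0 - a)), by linarith, hc.periodic (R.atAndreev_onPhase.1 haA) hbA⟩
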